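/- Let $p\in[1,\infty)$ and let $d=(d(1),d(2),\ldots)$ be a sequence of integers with $d(n)\ge 2$ for all $n\ge 1$. For a positive integer $m$, a \emph{diagonal system of $m$-similarities} is a triple $S=(I,s,f)$ in which $I$ is a countable set, $s\colon I\to \mathrm{inv}(M_m)$ is a function whose values are invertible diagonal complex $m\times m$ matrices, $1\in\mathrm{ran}(s)$, the closure $\overline{\mathrm{ran}(s)}$ in $M_m$ is compact and contained in $\mathrm{inv}(M_m)$, and $f\colon I\to(0,1]$ satisfies $\sum_{i\in I}f(i)=1$. Write $\|v\|_p$ for the operator norm of $v\in M_m$ acting on $\ell^p(\{1,\ldots,m\})$, and put $R_{p,S}=\sup_{i\in I}\|s(i)\|_p\,\|s(i)^{-1}\|_p$. Let $X_S=\{1,\ldots,m\}\times I$, with the $\sigma$-algebra of all subsets and the probability measure $\mu_S$ given by $\mu_S(\{(j,i)\})=f(i)/m$, and let $\psi^{p,S}\colon M_m\to L(L^p(X_S,\mu_S))$ be the $L^p$ direct sum over $i\in I$ of the representations $a\mapsto s(i)\,a\,s(i)^{-1}$ on $L^p(\{1,\ldots,m\}\times\{i\})$. Let $I=(I_1,I_2,\ldots)$,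 $s=(s_1,s_2,\ldots)$ and $f=(f_1,f_2,\ldots)$ be sequences such that $S_n=(I_n,s_n,f_n)$ is a diagonal system of $d(n)$-similarities for every $n\ge1$. Let $(X,\mu)=\prod_{n=1}^\infty(X_{S_n},\mu_{S_n})$ be the product probability space, and let $D_{p,d,I,s,f}\subset L(L^p(X,\mu))$ be the closed subalgebra generated by all operators \[\psi^{p,S_1}(a_1)\otimes\cdots\otimes\psi^{p,S_m}(a_m)\otimes 1\otimes 1\otimes\cdots,\qquad m\ge 0,\ a_k\in M_{d(k)}.\] If $D_{p,d,I,s,f}$ is amenable as a Banach algebra (that is, every bounded derivation from it into the dual of a Banach bimodule over it is inner), then \[\prod_{n=1}^\infty R_{p,S_n}<\infty .\] -/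

import Mathlib

open MeasureTheory Filter Topology
open scoped ENNReal NNReal

universe u

noncomputable section

/-! ### Amenability of Banach algebras -/

/-- A Banach `A`-bimodule structure on the Banach space `E`: the left action `x ↦ a · x` is
`left a`, the right action `x ↦ x · a` is `right a`, and both are jointly bounded. The identity of
`A` is not required to act as the identity. -/
structure BanachBimodule (A : Type u) [NormedRing A] [NormedAlgebra ℂ A]
    (E : Type u) [NormedAddCommGroup E] [NormedSpace ℂ E] where
  left : A →L[ℂ] E →L[ℂ] E
  right : A →L[ℂ] E →L[ℂ] E
  left_mul : ∀ (a b : A) (x : E), left (a * b) x = left a (left b x)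
  right_mul : ∀ (a b : A) (x : E), right (a * b) x = right b (right a x)
  left_right_comm : ∀ (a b : A) (x : E), right b (left a x) = left a (right b x)

namespace BanachBimodule

variable {A : Type u} [NormedRing A] [NormedAlgebra ℂ A]
  {E : Type u} [NormedAddCommGroup E] [NormedSpace ℂ E]

/-- Left action on the dual bimodule: `(a · φ)(x) = φ(x · a)`. -/
def dualLeft (M : BanachBimodule A E) (a : A) (φ : E →L[ℂ] ℂ) : E →L[ℂ] ℂ := φ.comp (M.right a)

/-- Right action on the dual bimodule: `(φ · a)(x) = φ(a · x)`. -/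
def dualRight (M : BanachBimodule A E) (φ : E →L[ℂ] ℂ) (a : A) : E →L[ℂ] ℂ := φ.comp (M.left a)

end BanachBimodule

/-- A Banach algebra `A` is amenable if, for every Banach `A`-bimodule `E`, every bounded
derivation `D : A → E*` is inner (that is, `H¹(A, E*) = 0`). -/
def IsAmenable (A : Type u) [NormedRing A] [NormedAlgebra ℂ A] : Prop :=
  ∀ (E : Type u) [NormedAddCommGroup E] [NormedSpace ℂ E] [CompleteSpace E]
    (M : BanachBimodule A E) (D : A →L[ℂ] (E →L[ℂ] ℂ)),
    (∀ a b : A, D (a * b) = M.dualLeft a (D b) + M.dualRight (D a) b) →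
      ∃ φ : E →L[ℂ] ℂ, ∀ a : A, D a = M.dualLeft a φ - M.dualRight φ a

/-! ### Systems of similarities -/

/-- A system of `d`-similarities with index set `I` (which is assumed countable wherever systems
of similarities are used). -/
structure SimilaritySystem (d : ℕ) (I : Type u) where
  d_pos : 0 < d
  s : I → GL (Fin d) ℂ
  f : I → ℝ
  one_mem_range : (1 : GL (Fin d) ℂ) ∈ Set.range s
  closure_isUnit : ∀ v ∈ closure (Set.range fun i => (s i : Matrix (Fin d) (Fin d) ℂ)), IsUnit v
  isCompact_closure : IsCompact (closure (Set.range fun i => (s i : Matrix (Fin d) (Fin d) ℂ)))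
  f_pos : ∀ i, 0 < f i
  hasSum_f : HasSum f 1

/-- The operator norm of the matrix `v` acting on `ℓ^p({1, …, d})`. -/
def matrixLpNorm (p : ℝ≥0∞) [Fact (1 ≤ p)] {d : ℕ} (v : Matrix (Fin d) (Fin d) ℂ) : ℝ≥0∞ :=
  ‖LinearMap.toContinuousLinearMap (Matrix.toLpLin p p v)‖ₑ

/-- The underlying set `{1, …, d} × I` of the measure space of a system of similarities, with the
`σ`-algebra of all subsets. -/
@[ext] structure SimilaritySpace (d : ℕ) (I : Type u) : Type u where
  row : Fin d
  idx : I

instance (d : ℕ) (I : Type u) : MeasurableSpace (SimilaritySpace d I) := ⊤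

/-- The obvious bijection with the cartesian product. -/
def SimilaritySpace.equivProd (d : ℕ) (I : Type u) : SimilaritySpace d I ≃ Fin d × I where
  toFun x := (x.row, x.idx)
  invFun y := ⟨y.1, y.2⟩

namespace SimilaritySystem

variable {d : ℕ} {I : Type u}

/-- The system is diagonal: every `s i` is a diagonal matrix. -/
def IsDiagonal (S : SimilaritySystem d I) : Prop :=
  ∀ i, (S.s i : Matrix (Fin d) (Fin d) ℂ).IsDiag

/-- The `p`-bound `R_{p,S} = sup_i ‖s i‖_p ‖(s i)⁻¹‖_p`. -/
def pBound (p : ℝ≥0∞) [Fact (1 ≤ p)] (S : SimilaritySystem d I) : ℝ≥0∞ :=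
  ⨆ i, matrixLpNorm p (S.s i : Matrix (Fin d) (Fin d) ℂ) *
    matrixLpNorm p (((S.s i)⁻¹ : GL (Fin d) ℂ) : Matrix (Fin d) (Fin d) ℂ)

/-- The atomic measure on `{1, …, d} × I` with `μ {(j, i)} = f i / d`. -/
def measure (S : SimilaritySystem d I) : Measure (SimilaritySpace d I) :=
  Measure.sum fun x : SimilaritySpace d I => ENNReal.ofReal (S.f x.idx / d) • Measure.dirac x

/-- The matrix `s i * a * (s i)⁻¹`. -/
def conj (S : SimilaritySystem d I) (a : Matrix (Fin d) (Fin d) ℂ) (i : I) :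
    Matrix (Fin d) (Fin d) ℂ :=
  (S.s i : Matrix (Fin d) (Fin d) ℂ) * a *
    (((S.s i)⁻¹ : GL (Fin d) ℂ) : Matrix (Fin d) (Fin d) ℂ)

theorem measure_apply (S : SimilaritySystem d I) (B : Set (SimilaritySpace d I)) :
    S.measure B = ∑' x : SimilaritySpace d I, ENNReal.ofReal (S.f x.idx / d) * B.indicator 1 x := by
  rw [measure, Measure.sum_apply _ (MeasurableSpace.measurableSet_top)]
  refine tsum_congr fun x => ?_
  rw [Measure.smul_apply, Measure.dirac_apply' _ (MeasurableSpace.measurableSet_top), smul_eq_mul]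

instance (S : SimilaritySystem d I) : IsProbabilityMeasure S.measure := by
  constructor
  have hd : (0 : ℝ) < d := Nat.cast_pos.2 S.d_pos
  rw [measure_apply]
  have h1 : ∑' i, ENNReal.ofReal (S.f i / d) = ENNReal.ofReal (1 / d) := by
    rw [← ENNReal.ofReal_tsum_of_nonneg (fun i => (div_pos (S.f_pos i) hd).le)
      (S.hasSum_f.summable.div_const _), (S.hasSum_f.div_const _).tsum_eq]
  calc _ = ∑' x : SimilaritySpace d I, ENNReal.ofReal (S.f x.idx / d) :=
        tsum_congr fun x => by rw [Set.indicator_univ, Pi.one_apply, mul_one]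
    _ = ∑' x : Fin d × I, ENNReal.ofReal (S.f x.2 / d) :=
        (SimilaritySpace.equivProd d I).tsum_eq fun x => ENNReal.ofReal (S.f x.2 / d)
    _ = ∑' (_ : Fin d) (i : I), ENNReal.ofReal (S.f i / d) :=
        ENNReal.tsum_prod (f := fun _ i => ENNReal.ofReal (S.f i / d))
    _ = ∑' _ : Fin d, ENNReal.ofReal (1 / d) := by simp only [h1]
    _ = 1 := by
      rw [tsum_fintype, Finset.sum_const, Finset.card_univ, Fintype.card_fin, nsmul_eq_mul,
        ← ENNReal.ofReal_natCast, ← ENNReal.ofReal_mul (Nat.cast_nonneg _), mul_one_div,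
        div_self hd.ne', ENNReal.ofReal_one]

theorem map_measure_perm (S : SimilaritySystem d I) (e : Equiv.Perm (Fin d)) :
    S.measure.map (fun x => (⟨e x.row, x.idx⟩ : SimilaritySpace d I)) = S.measure := by
  ext B hB
  rw [Measure.map_apply measurable_from_top hB, measure_apply, measure_apply]
  exact (((SimilaritySpace.equivProd d I).trans (Equiv.prodCongr e (Equiv.refl I))).trans
    (SimilaritySpace.equivProd d I).symm).tsum_eq
    (fun x : SimilaritySpace d I => ENNReal.ofReal (S.f x.idx / d) * B.indicator 1 x)

theorem exists_conj_bound (S : SimilaritySystem d I) (a : Matrix (Fin d) (Fin d) ℂ)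
    (j k : Fin d) : ∃ K : ℝ, ∀ i, ‖S.conj a i j k‖ ≤ K := by
  have hcont : ContinuousOn (fun v : Matrix (Fin d) (Fin d) ℂ => (v * a * v⁻¹) j k)
      (closure (Set.range fun i => (S.s i : Matrix (Fin d) (Fin d) ℂ))) := by
    intro v hv
    have hdet : v.det ≠ 0 := ((Matrix.isUnit_iff_isUnit_det v).1 (S.closure_isUnit v hv)).ne_zero
    have hinv : ContinuousAt (fun v : Matrix (Fin d) (Fin d) ℂ => v⁻¹) v := by
      apply continuousAt_matrix_inv
      simpa using continuousAt_inv₀ hdet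
    have h : ContinuousAt (fun v : Matrix (Fin d) (Fin d) ℂ => v * a * v⁻¹) v :=
      (continuousAt_id.mul continuousAt_const).mul hinv
    exact ((continuous_apply k).continuousAt.comp
      ((continuous_apply j).continuousAt.comp h)).continuousWithinAt
  obtain ⟨K, hK⟩ := (S.isCompact_closure).exists_bound_of_continuousOn hcont
  refine ⟨K, fun i => ?_⟩
  have := hK _ (subset_closure ⟨i, rfl⟩)
  simpa [conj, Matrix.coe_units_inv] using this

end SimilaritySystem

/-! ### The algebra -/

theorem quasiMeasurePreserving_of_map_le {X : Type u} [MeasurableSpace X] {μ : Measure X}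
    {τ : X → X} (hτ : Measurable τ) (hC : ∃ C : ℝ≥0, μ.map τ ≤ (C : ℝ≥0∞) • μ) :
    Measure.QuasiMeasurePreserving τ μ μ := by
  obtain ⟨C, hC⟩ := hC
  exact ⟨hτ, (Measure.absolutelyContinuous_of_le hC).trans Measure.smul_absolutelyContinuous⟩

theorem memLp_comp_of_map_le (p : ℝ≥0∞) {X : Type u} [MeasurableSpace X] {μ : Measure X}
    {τ : X → X} (hτ : Measurable τ) (hC : ∃ C : ℝ≥0, μ.map τ ≤ (C : ℝ≥0∞) • μ) (ξ : Lp ℂ p μ) :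
    MemLp (fun x => ξ (τ x)) p μ := by
  obtain ⟨C, hC⟩ := hC
  exact ((Lp.memLp ξ).of_measure_le_smul ENNReal.coe_ne_top hC).comp_of_map hτ.aemeasurable

theorem memLp_weightedComp (p : ℝ≥0∞) {X : Type u} [MeasurableSpace X] {μ : Measure X}
    {c : X → ℂ} {τ : X → X} (hc : Measurable c) (hb : ∃ K : ℝ, ∀ x, ‖c x‖ ≤ K)
    (hτ : Measurable τ) (hC : ∃ C : ℝ≥0, μ.map τ ≤ (C : ℝ≥0∞) • μ) (ξ : Lp ℂ p μ) :
    MemLp (fun x => c x * ξ (τ x)) p μ := by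
  obtain ⟨K, hb⟩ := hb
  have h1 := memLp_comp_of_map_le p hτ hC ξ
  exact h1.of_le_mul (c := K) (hc.aestronglyMeasurable.mul h1.1)
    (Eventually.of_forall fun x => by
      rw [norm_mul]; exact mul_le_mul_of_nonneg_right (hb x) (norm_nonneg _))

/-- The bounded operator `ξ ↦ c · (ξ ∘ τ)` on `L^p(μ)`, for a bounded measurable function `c` and
a measurable map `τ` whose push-forward of `μ` is dominated by a multiple of `μ`. -/
def weightedComp (p : ℝ≥0∞) [Fact (1 ≤ p)] {X : Type u} [MeasurableSpace X] (μ : Measure X)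
    (c : X → ℂ) (τ : X → X) (hc : Measurable c) (hb : ∃ K : ℝ, ∀ x, ‖c x‖ ≤ K)
    (hτ : Measurable τ) (hC : ∃ C : ℝ≥0, μ.map τ ≤ (C : ℝ≥0∞) • μ) :
    Lp ℂ p μ →L[ℂ] Lp ℂ p μ :=
  LinearMap.mkContinuousOfExistsBound
    { toFun := fun ξ => (memLp_weightedComp p hc hb hτ hC ξ).toLp
      map_add' := fun ξ η => by
        rw [← MemLp.toLp_add]
        refine MemLp.toLp_congr _ _ ?_
        filter_upwards [(quasiMeasurePreserving_of_map_le hτ hC).ae (Lp.coeFn_add ξ η)] with x hx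
        rw [hx]; simp [mul_add]
      map_smul' := fun r ξ => by
        rw [RingHom.id_apply, ← MemLp.toLp_const_smul]
        refine MemLp.toLp_congr _ _ ?_
        filter_upwards [(quasiMeasurePreserving_of_map_le hτ hC).ae (Lp.coeFn_smul r ξ)] with x hx
        rw [hx]; simp [mul_left_comm] }
    (by
      have qmp := quasiMeasurePreserving_of_map_le hτ hC
      have mem := memLp_weightedComp p hc hb hτ hC
      have h1 := memLp_comp_of_map_le p hτ hC
      obtain ⟨C, hC⟩ := hC
      obtain ⟨K, hb⟩ := hb
      refine ⟨|K| * ((C : ℝ≥0∞) ^ (1 / p).toReal).toReal, fun ξ => ?_⟩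
      have h2 : ‖(h1 ξ).toLp‖ ≤ ((C : ℝ≥0∞) ^ (1 / p).toReal).toReal * ‖ξ‖ := by
        rw [Lp.norm_toLp, Lp.norm_def, ← ENNReal.toReal_mul]
        refine ENNReal.toReal_mono (ENNReal.mul_ne_top ?_ (Lp.eLpNorm_ne_top ξ)) ?_
        · exact ENNReal.rpow_ne_top_of_nonneg ENNReal.toReal_nonneg ENNReal.coe_ne_top
        · have h3 : eLpNorm (fun x => ξ (τ x)) p μ = eLpNorm ξ p (μ.map τ) :=
            (eLpNorm_map_measure ((Lp.aestronglyMeasurable ξ).mono_ac qmp.2)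
              hτ.aemeasurable).symm
          rw [h3]
          exact eLpNorm_le_of_measure_le_smul hC
      have h4 : ‖(mem ξ).toLp‖ ≤ |K| * ‖(h1 ξ).toLp‖ := by
        refine Lp.norm_le_mul_norm_of_ae_le_mul ?_
        filter_upwards [(mem ξ).coeFn_toLp, (h1 ξ).coeFn_toLp] with x hx hx'
        rw [hx, hx', norm_mul]
        exact mul_le_mul_of_nonneg_right ((hb x).trans (le_abs_self K)) (norm_nonneg _)
      calc _ ≤ |K| * ‖(h1 ξ).toLp‖ := h4
        _ ≤ |K| * (((C : ℝ≥0∞) ^ (1 / p).toReal).toReal * ‖ξ‖) :=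
          mul_le_mul_of_nonneg_left h2 (abs_nonneg _)
        _ = _ := by ring)

theorem weightedComp_ae (p : ℝ≥0∞) [Fact (1 ≤ p)] {X : Type u} [MeasurableSpace X]
    (μ : Measure X) (c : X → ℂ) (τ : X → X) (hc : Measurable c) (hb : ∃ K : ℝ, ∀ x, ‖c x‖ ≤ K)
    (hτ : Measurable τ) (hC : ∃ C : ℝ≥0, μ.map τ ≤ (C : ℝ≥0∞) • μ) (ξ : Lp ℂ p μ) :
    weightedComp p μ c τ hc hb hτ hC ξ =ᵐ[μ] fun x => c x * ξ (τ x) :=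
  (memLp_weightedComp p hc hb hτ hC ξ).coeFn_toLp

section Algebra

variable {d : ℕ → ℕ} {I : ℕ → Type u}

/-- The probability measure on `∏ n, {1, …, d n} × I n` which is the product of the measures of
the systems `S n`. -/
def productMeasure (S : ∀ n, SimilaritySystem (d n) (I n)) :
    Measure (∀ n, SimilaritySpace (d n) (I n)) :=
  Measure.infinitePi fun n => (S n).measure

/-- Replace the `n`-th coordinate `(j, i)` of a point by `(k, i)`. -/
def setRow (n : ℕ) (k : Fin (d n)) (x : ∀ m, SimilaritySpace (d m) (I m)) :
    ∀ m, SimilaritySpace (d m) (I m) :=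
  Function.update x n ⟨k, (x n).idx⟩

theorem measurable_setRow (n : ℕ) (k : Fin (d n)) :
    Measurable (setRow (I := I) n k) := by
  refine measurable_pi_lambda _ fun m => ?_
  by_cases h : m = n
  · subst h
    simp only [setRow, Function.update_self]
    exact (measurable_from_top (f := fun y : SimilaritySpace (d m) (I m) =>
      (⟨k, y.idx⟩ : SimilaritySpace (d m) (I m)))).comp (measurable_pi_apply m)
  · simp only [setRow, Function.update_of_ne h]
    exact measurable_pi_apply m

theorem map_setRow_le (S : ∀ n, SimilaritySystem (d n) (I n)) (n : ℕ) (k : Fin (d n)) :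
    (productMeasure S).map (setRow n k) ≤ ((d n : ℝ≥0) : ℝ≥0∞) • productMeasure S := by
  refine Measure.le_iff.2 fun B hB => ?_
  rw [Measure.map_apply (measurable_setRow n k) hB, Measure.smul_apply, smul_eq_mul]
  let e : Fin (d n) → ∀ m, Equiv.Perm (Fin (d m)) := fun j =>
    Function.update (fun _ => 1) n (Equiv.swap j k)
  let g : Fin (d n) → (∀ m, SimilaritySpace (d m) (I m)) → ∀ m, SimilaritySpace (d m) (I m) :=
    fun j x m => ⟨e j m (x m).row, (x m).idx⟩
  have hmap : ∀ j, (productMeasure S).map (g j) = productMeasure S := fun j => by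
    have := Measure.infinitePi_map_pi (μ := fun m => (S m).measure)
      (f := fun m (y : SimilaritySpace (d m) (I m)) =>
        (⟨e j m y.row, y.idx⟩ : SimilaritySpace (d m) (I m))) (fun m => measurable_from_top)
    simp only [SimilaritySystem.map_measure_perm] at this
    exact this
  have hg : ∀ j, Measurable (g j) := fun j => measurable_pi_lambda _ fun m =>
    (measurable_from_top (f := fun y : SimilaritySpace (d m) (I m) =>
      (⟨e j m y.row, y.idx⟩ : SimilaritySpace (d m) (I m)))).comp (measurable_pi_apply m)
  have hsub : setRow n k ⁻¹' B ⊆ ⋃ j ∈ (Finset.univ : Finset (Fin (d n))), g j ⁻¹' B := by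
    intro x hx
    simp only [Finset.mem_univ, Set.iUnion_true, Set.mem_iUnion, Set.mem_preimage]
    refine ⟨(x n).row, ?_⟩
    have : g (x n).row x = setRow n k x := by
      funext m
      by_cases h : m = n
      · subst h; simp [g, e, setRow]
      · simp [g, e, setRow, Function.update_of_ne h]
    rw [this]; exact hx
  calc productMeasure S (setRow n k ⁻¹' B)
      ≤ ∑ j : Fin (d n), productMeasure S (g j ⁻¹' B) :=
        (measure_mono hsub).trans (measure_biUnion_finset_le _ _)
    _ = ∑ _ : Fin (d n), productMeasure S B := by
        refine Finset.sum_congr rfl fun j _ => ?_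
        rw [← Measure.map_apply (hg j) hB, hmap]
    _ = _ := by simp

/-- The operator `1 ⊗ ⋯ ⊗ 1 ⊗ ρ_n(a) ⊗ 1 ⊗ ⋯` on `L^p` of the infinite product, where `ρ_n` is
the representation of the `d n` by `d n` matrices on `L^p({1, …, d n} × I n)` which is the `L^p`
direct sum over `i : I n` of the representations `a ↦ s i * a * (s i)⁻¹`. Explicitly, at a point
`x` with `x n = (j, i)`, its value on `ξ` is
`∑ k, (s i * a * (s i)⁻¹) j k * ξ (x with n-th coordinate (k, i))`; see `slotOp_ae`. -/
def slotOp (p : ℝ≥0∞) [Fact (1 ≤ p)] (S : ∀ n, SimilaritySystem (d n) (I n)) (n : ℕ)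
    (a : Matrix (Fin (d n)) (Fin (d n)) ℂ) :
    Lp ℂ p (productMeasure S) →L[ℂ] Lp ℂ p (productMeasure S) :=
  ∑ k : Fin (d n), weightedComp p (productMeasure S)
    (fun x => (S n).conj a (x n).idx (x n).row k) (setRow n k)
    ((measurable_from_top (f := fun y : SimilaritySpace (d n) (I n) =>
      (S n).conj a y.idx y.row k)).comp (measurable_pi_apply n))
    (by
      choose K hK using fun j => (S n).exists_conj_bound a j k
      refine ⟨∑ j, |K j|, fun x => (hK _ _).trans ((le_abs_self _).trans ?_)⟩
      exact Finset.single_le_sum (f := fun j => |K j|) (fun j _ => abs_nonneg _)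
        (Finset.mem_univ (x n).row))
    (measurable_setRow n k) ⟨d n, map_setRow_le S n k⟩

theorem slotOp_ae (p : ℝ≥0∞) [Fact (1 ≤ p)] (S : ∀ n, SimilaritySystem (d n) (I n)) (n : ℕ)
    (a : Matrix (Fin (d n)) (Fin (d n)) ℂ) (ξ : Lp ℂ p (productMeasure S)) :
    slotOp p S n a ξ =ᵐ[productMeasure S]
      fun x => ∑ k : Fin (d n), (S n).conj a (x n).idx (x n).row k *
        ξ (Function.update x n ⟨k, (x n).idx⟩) := by
  rw [slotOp, sum_apply]
  refine (Lp.coeFn_finsetSum _ _).trans ?_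
  have h := fun k : Fin (d n) => weightedComp_ae p (productMeasure S)
    (fun x => (S n).conj a (x n).idx (x n).row k) (setRow n k)
    ((measurable_from_top (f := fun y : SimilaritySpace (d n) (I n) =>
      (S n).conj a y.idx y.row k)).comp (measurable_pi_apply n))
    (by
      choose K hK using fun j => (S n).exists_conj_bound a j k
      refine ⟨∑ j, |K j|, fun x => (hK _ _).trans ((le_abs_self _).trans ?_)⟩
      exact Finset.single_le_sum (f := fun j => |K j|) (fun j _ => abs_nonneg _)
        (Finset.mem_univ (x n).row))
    (measurable_setRow n k) ⟨d n, map_setRow_le S n k⟩ ξ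
  filter_upwards [ae_all_iff.2 h] with x hx
  rw [Finset.sum_apply]
  exact Finset.sum_congr rfl fun k _ => hx k

/-- The algebra `D_{p,d,I,s,f}`: the closed subalgebra of the bounded operators on `L^p` of the
infinite product which is generated by the operators
`ρ_1(a_1) ⊗ ⋯ ⊗ ρ_m(a_m) ⊗ 1 ⊗ 1 ⊗ ⋯`; as these are the finite products of the operators
`slotOp p S n a`, the latter generate the same closed subalgebra. -/
def uhfAlgebra (p : ℝ≥0∞) [Fact (1 ≤ p)] (S : ∀ n, SimilaritySystem (d n) (I n)) :
    Subalgebra ℂ (Lp ℂ p (productMeasure S) →L[ℂ] Lp ℂ p (productMeasure S)) :=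
  (Algebra.adjoin ℂ {T | ∃ (n : ℕ) (a : Matrix (Fin (d n)) (Fin (d n)) ℂ),
    T = slotOp p S n a}).topologicalClosure

end Algebra

end

/-!
The proof bounds the product of the numbers `R` by the norm of a virtual diagonal of the algebra.

An amenable unital Banach algebra has a virtual diagonal, that is, a bounded functional on bilinear
forms that behaves like an element `∑ aₖ ⊗ bₖ` which commutes with the algebra and satisfies
`∑ aₖ bₖ = 1` (`IsAmenable.exists_virtualDiagonal`). For an algebra of operators it defines averages
`T ↦ ∑ aₖ T bₖ` of operators `T`; these commute with the algebra, have norm at most a constant times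
`‖T‖`, are linear over the commutant, and fix the identity (`Averaging`).

Fix `N` and indices `i n` for `n < N`, and let `o n` be indices with `s (o n) = 1`. On the slices of
the product space where the first `N` indices are `i`, or are `o`, the algebra acts by two
representations which are similar through the diagonal matrix with entries
`q r = ∏ s (i n) (r n) (r n)`, where `r` is a sequence of rows. The weighted translation operators
`transfer` between the two slices, with `q` or its inverse as weight, lie in the commutant
(`transfer_entryRatio_mul_of_mem`), and up to the ratio of the weights of the slices the norm of
such an operator is the supremum of its weight (`norm_transfer_apply_le`).

Let `Λ g` be the normalized diagonal matrix coefficient, at a sequence of rows `k`, of the average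
of the operator of multiplication by the function `g` of the rows. It does not depend on the slice,
because conjugation by a diagonal matrix does not change diagonal entries
(`sliceWeight_mul_cellCoeff`), nor on `k`, because averages commute with matrix units
(`cellCoeff_eq_cellCoeff`). Composing with the weighted translations gives, for a constant `C`
which depends on the virtual diagonal only,
`‖Λ g‖ ≤ C * ‖g / q‖ * ‖q k‖` and `‖Λ g‖ ≤ C * ‖g * q‖ / ‖q k'‖` for all sequences of rows `k`, `k'`
(`norm_cellCoeff_le`, `norm_cellCoeff_le'`).
Since `Λ 1 = 1`, splitting `1 = g + g'` with `g = ‖q‖ / (‖q‖ + m)` and `m ^ 2 = ‖q k‖ * ‖q k'‖`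
yields `1 ≤ 2 * C * √(‖q k‖ / ‖q k'‖)`, hence `‖q k'‖ / ‖q k‖ ≤ 4 * C ^ 2` (`norm_entryRatio_le`).
With `k'` and `k` at the largest and the smallest entries, the left side bounds the product of the
numbers `‖s (i n)‖ * ‖(s (i n))⁻¹‖`, and the supremum over `i` bounds the product of the numbers
`R`.
-/

noncomputable section

/-! ### Virtual diagonals -/

section VirtualDiagonal

open ContinuousLinearMap

set_option maxSynthPendingDepth 3

variable {A : Type u} [NormedRing A] [NormedAlgebra ℂ A]

/-- The bounded bilinear form `(a, b) ↦ f (a * b)`, depending linearly on the functional `f`. -/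
def mulForm (A : Type u) [NormedRing A] [NormedAlgebra ℂ A] :
    (A →L[ℂ] ℂ) →L[ℂ] A →L[ℂ] A →L[ℂ] ℂ :=
  ((compL ℂ A (A →L[ℂ] A) (A →L[ℂ] ℂ)).flip (ContinuousLinearMap.mul ℂ A)).comp (compL ℂ A A ℂ)

@[simp] theorem mulForm_apply (f : A →L[ℂ] ℂ) (a b : A) : mulForm A f a b = f (a * b) := rfl

/-- The projection `φ ↦ ((a, b) ↦ φ a b - φ 1 (a * b))` of the space of bounded bilinear forms,
whose kernel is the set of the forms `(a, b) ↦ f (a * b)`. -/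
def subMulForm (A : Type u) [NormedRing A] [NormedAlgebra ℂ A] :
    (A →L[ℂ] A →L[ℂ] ℂ) →L[ℂ] A →L[ℂ] A →L[ℂ] ℂ :=
  ContinuousLinearMap.id ℂ _ - (mulForm A).comp (ContinuousLinearMap.apply ℂ (A →L[ℂ] ℂ) (1 : A))

@[simp] theorem subMulForm_apply (φ : A →L[ℂ] A →L[ℂ] ℂ) (a b : A) :
    subMulForm A φ a b = φ a b - φ 1 (a * b) := rfl

/-- The action `x ↦ (φ ↦ ((a, b) ↦ φ (x * a) b))` on bounded bilinear forms. -/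
def formMulLeft (A : Type u) [NormedRing A] [NormedAlgebra ℂ A] :
    A →L[ℂ] (A →L[ℂ] A →L[ℂ] ℂ) →L[ℂ] A →L[ℂ] A →L[ℂ] ℂ :=
  (compL ℂ A A (A →L[ℂ] ℂ)).flip.comp (ContinuousLinearMap.mul ℂ A)

@[simp] theorem formMulLeft_apply (x : A) (φ : A →L[ℂ] A →L[ℂ] ℂ) (a b : A) :
    formMulLeft A x φ a b = φ (x * a) b := rfl

/-- The action `x ↦ (φ ↦ ((a, b) ↦ φ a (b * x)))` on bounded bilinear forms. -/
def formMulRight (A : Type u) [NormedRing A] [NormedAlgebra ℂ A] :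
    A →L[ℂ] (A →L[ℂ] A →L[ℂ] ℂ) →L[ℂ] A →L[ℂ] A →L[ℂ] ℂ :=
  (compL ℂ A (A →L[ℂ] ℂ) (A →L[ℂ] ℂ)).comp
    ((compL ℂ A A ℂ).flip.comp (ContinuousLinearMap.mul ℂ A).flip)

@[simp] theorem formMulRight_apply (x : A) (φ : A →L[ℂ] A →L[ℂ] ℂ) (a b : A) :
    formMulRight A x φ a b = φ a (b * x) := rfl

/-- The bounded bilinear forms modulo the forms `(a, b) ↦ f (a * b)`, as a Banach bimodule. The
quotient is realized on the space of all forms, by composing both actions with the projection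
`subMulForm`. -/
def formBimodule (A : Type u) [NormedRing A] [NormedAlgebra ℂ A] :
    BanachBimodule A (A →L[ℂ] A →L[ℂ] ℂ) where
  left := (compL ℂ _ _ _ (subMulForm A)).comp (formMulRight A)
  right := (compL ℂ _ _ _ (subMulForm A)).comp (formMulLeft A)
  left_mul a b φ := by ext x y; simp [mul_assoc]
  right_mul a b φ := by ext x y; simp [mul_assoc]
  left_right_comm a b φ := by ext x y; simp [mul_assoc]

theorem formBimodule_left_apply (x : A) (φ : A →L[ℂ] A →L[ℂ] ℂ) :
    (formBimodule A).left x φ = subMulForm A (formMulRight A x φ) := rfl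

theorem formBimodule_right_apply (x : A) (φ : A →L[ℂ] A →L[ℂ] ℂ) :
    (formBimodule A).right x φ = subMulForm A (formMulLeft A x φ) := rfl

/-- The functional `φ ↦ φ x 1 - φ 1 x` on bilinear forms, that is, the commutator of `x` with
`1 ⊗ 1`. -/
def formDerivation (A : Type u) [NormedRing A] [NormedAlgebra ℂ A] :
    A →L[ℂ] (A →L[ℂ] A →L[ℂ] ℂ) →L[ℂ] ℂ :=
  (compL ℂ _ _ _ (ContinuousLinearMap.apply ℂ ℂ (1 : A))).comp
      (ContinuousLinearMap.apply ℂ (A →L[ℂ] ℂ)) -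
    ((compL ℂ (A →L[ℂ] A →L[ℂ] ℂ) (A →L[ℂ] ℂ) ℂ).flip
      (ContinuousLinearMap.apply ℂ (A →L[ℂ] ℂ) (1 : A))).comp (ContinuousLinearMap.apply ℂ ℂ)

@[simp] theorem formDerivation_apply (x : A) (φ : A →L[ℂ] A →L[ℂ] ℂ) :
    formDerivation A x φ = φ x 1 - φ 1 x := rfl

/-- A unital amenable Banach algebra has a virtual diagonal: a bounded functional `V` on bilinear
forms which behaves like the evaluation at an element `∑ aₖ ⊗ bₖ` that commutes with the algebra
and satisfies `∑ aₖ * bₖ = 1`. -/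
theorem IsAmenable.exists_virtualDiagonal (h : IsAmenable A) :
    ∃ (V : (A →L[ℂ] A →L[ℂ] ℂ) →ₗ[ℂ] ℂ) (C : ℝ), 0 ≤ C ∧ (∀ φ, ‖V φ‖ ≤ C * ‖φ‖) ∧
      (∀ (x : A) (φ : A →L[ℂ] A →L[ℂ] ℂ), V (formMulLeft A x φ) = V (formMulRight A x φ)) ∧
      ∀ f : A →L[ℂ] ℂ, V (mulForm A f) = f 1 := by
  obtain ⟨N, hN⟩ := h (A →L[ℂ] A →L[ℂ] ℂ) (formBimodule A) (formDerivation A) (by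
    intro a b
    ext φ
    simp [BanachBimodule.dualLeft, BanachBimodule.dualRight, formBimodule_left_apply,
      formBimodule_right_apply])
  -- The derivation is the commutator with `1 ⊗ 1` and also with `N`, which vanishes on the forms
  -- `(a, b) ↦ f (a * b)`; so the difference of the two is a virtual diagonal.
  let V : (A →L[ℂ] A →L[ℂ] ℂ) →L[ℂ] ℂ := (ContinuousLinearMap.apply ℂ ℂ (1 : A)).comp
    (ContinuousLinearMap.apply ℂ (A →L[ℂ] ℂ) (1 : A)) - N.comp (subMulForm A)
  have hVapp : ∀ φ, V φ = φ 1 1 - N (subMulForm A φ) := fun φ => rfl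
  refine ⟨V.toLinearMap, ‖V‖, norm_nonneg V, V.le_opNorm, fun x φ => ?_, fun f => ?_⟩
  · have h1 := congrArg (fun T : (A →L[ℂ] A →L[ℂ] ℂ) →L[ℂ] ℂ => T φ) (hN x)
    simp only [formDerivation_apply, BanachBimodule.dualLeft, BanachBimodule.dualRight,
      sub_apply, comp_apply, formBimodule_left_apply, formBimodule_right_apply] at h1
    simp only [ContinuousLinearMap.coe_coe, hVapp, formMulLeft_apply, formMulRight_apply, mul_one,
      one_mul]
    linear_combination h1
  · have h2 : subMulForm A (mulForm A f) = 0 := by ext a b; simp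
    simp [hVapp, h2]

end VirtualDiagonal

/-! ### Diagonal systems of similarities -/

namespace SimilaritySystem

variable {d : ℕ} {I : Type u}

theorem IsDiagonal.s_eq {S : SimilaritySystem d I} (h : S.IsDiagonal) (i : I) :
    (S.s i : Matrix (Fin d) (Fin d) ℂ) = Matrix.diagonal fun r => S.s i r r :=
  ((h i).diagonal_diag).symm

theorem IsDiagonal.apply_ne_zero {S : SimilaritySystem d I} (h : S.IsDiagonal) (i : I)
    (r : Fin d) : S.s i r r ≠ 0 := by
  have hu : IsUnit (S.s i : Matrix (Fin d) (Fin d) ℂ) := (S.s i).isUnit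
  rw [h.s_eq i, Matrix.isUnit_diagonal, Pi.isUnit_iff] at hu
  exact (hu r).ne_zero

theorem IsDiagonal.s_inv_eq {S : SimilaritySystem d I} (h : S.IsDiagonal) (i : I) :
    (((S.s i)⁻¹ : GL (Fin d) ℂ) : Matrix (Fin d) (Fin d) ℂ) =
      Matrix.diagonal fun r => (S.s i r r)⁻¹ := by
  rw [Matrix.coe_units_inv]
  refine Matrix.inv_eq_right_inv ?_
  conv_lhs => rw [h.s_eq i]
  rw [Matrix.diagonal_mul_diagonal, ← Matrix.diagonal_one]
  congr 1
  funext r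
  simp [h.apply_ne_zero i r]

theorem IsDiagonal.conj_apply {S : SimilaritySystem d I} (h : S.IsDiagonal)
    (a : Matrix (Fin d) (Fin d) ℂ) (i : I) (r c : Fin d) :
    S.conj a i r c = S.s i r r * a r c * (S.s i c c)⁻¹ := by
  rw [conj, h.s_inv_eq, Matrix.mul_diagonal, h.s_eq i, Matrix.diagonal_mul]
  simp

theorem conj_eq_self_of_eq_one (S : SimilaritySystem d I) {i : I} (hi : S.s i = 1)
    (a : Matrix (Fin d) (Fin d) ℂ) : S.conj a i = a := by
  simp [conj, hi]

theorem one_le_pBound (p : ℝ≥0∞) [Fact (1 ≤ p)] (S : SimilaritySystem d I) :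
    1 ≤ S.pBound p := by
  obtain ⟨i, hi⟩ := S.one_mem_range
  refine le_trans ?_ (le_iSup _ i)
  have : Nonempty (Fin d) := ⟨⟨0, S.d_pos⟩⟩
  have : Nontrivial (WithLp p (Fin d → ℂ)) := (WithLp.equiv p (Fin d → ℂ)).nontrivial
  have h1 : matrixLpNorm p (1 : Matrix (Fin d) (Fin d) ℂ) = 1 := by
    rw [matrixLpNorm, Matrix.toLpLin_one]
    have : LinearMap.toContinuousLinearMap (LinearMap.id : WithLp p (Fin d → ℂ) →ₗ[ℂ] _) =
        ContinuousLinearMap.id ℂ _ := rfl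
    rw [this, ← ofReal_norm, ContinuousLinearMap.norm_id, ENNReal.ofReal_one]
  simp [hi, h1]

end SimilaritySystem

theorem matrixLpNorm_diagonal_le (p : ℝ≥0∞) [Fact (1 ≤ p)] (hp : p ≠ ∞) {d : ℕ} (v : Fin d → ℂ)
    {K : ℝ} (hK : ∀ r, ‖v r‖ ≤ K) (hK0 : 0 ≤ K) :
    matrixLpNorm p (Matrix.diagonal v) ≤ ENNReal.ofReal K := by
  rw [matrixLpNorm, ← ofReal_norm]
  refine ENNReal.ofReal_le_ofReal (ContinuousLinearMap.opNorm_le_bound _ hK0 fun x => ?_)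
  have hp0 : 0 < p.toReal :=
    ENNReal.toReal_pos (zero_lt_one.trans_le (Fact.out : 1 ≤ p)).ne' hp
  rw [PiLp.norm_eq_sum hp0, PiLp.norm_eq_sum hp0]
  have h1 : K = (K ^ p.toReal) ^ (1 / p.toReal) := by
    rw [← Real.rpow_mul hK0, mul_one_div_cancel hp0.ne', Real.rpow_one]
  rw [h1, ← Real.mul_rpow (Real.rpow_nonneg hK0 _)
    (Finset.sum_nonneg fun r _ => Real.rpow_nonneg (norm_nonneg _) _)]
  refine Real.rpow_le_rpow (Finset.sum_nonneg fun r _ => Real.rpow_nonneg (norm_nonneg _) _) ?_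
    (by positivity)
  rw [Finset.mul_sum]
  refine Finset.sum_le_sum fun r _ => ?_
  rw [← Real.mul_rpow hK0 (norm_nonneg _)]
  refine Real.rpow_le_rpow (norm_nonneg _) ?_ hp0.le
  have : (LinearMap.toContinuousLinearMap (Matrix.toLpLin p p (Matrix.diagonal v)) x).ofLp r =
      v r * x.ofLp r := by
    simp [Matrix.mulVec_diagonal]
  rw [this, norm_mul]
  exact mul_le_mul_of_nonneg_right (hK r) (norm_nonneg _)

/-- If all choices of one factor from each of finitely many families have a product at most `K`,
then so does the product of the suprema. -/
theorem prod_range_iSup_le {J : ℕ → Type u} [∀ n, Nonempty (J n)] (r : ∀ n, J n → ℝ≥0∞) (N : ℕ)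
    (K : ℝ≥0∞) (h : ∀ i : ∀ n, J n, ∏ n ∈ Finset.range N, r n (i n) ≤ K) :
    ∏ n ∈ Finset.range N, ⨆ i, r n i ≤ K := by
  -- The suprema are inserted one factor at a time.
  have key : ∀ M ≤ N, ∀ i : ∀ n, J n,
      (∏ n ∈ Finset.range M, ⨆ j, r n j) * ∏ n ∈ Finset.Ico M N, r n (i n) ≤ K := by
    intro M
    induction M with
    | zero => intro _ i; simpa using h i
    | succ M ih =>
      intro hM i
      rw [Finset.prod_range_succ, mul_assoc, ENNReal.iSup_mul, ENNReal.mul_iSup]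
      refine iSup_le fun j => ?_
      have h1 := ih (Nat.le_of_succ_le hM) (Function.update i M j)
      rw [Finset.prod_eq_prod_Ico_succ_bot (Nat.lt_of_succ_le hM), Function.update_self] at h1
      refine le_trans (le_of_eq ?_) h1
      congr 2
      refine Finset.prod_congr rfl fun n hn => ?_
      rw [Function.update_of_ne]
      have := (Finset.mem_Ico.1 hn).1
      omega
  simpa using key N le_rfl fun n => Classical.arbitrary (J n)

/-! ### Slices and cells of the product space -/

section Slices

variable {d : ℕ → ℕ} {I : ℕ → Type u}

/-- The points whose first `N` coordinates have the second components `i 0, …, i (N - 1)`. -/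
def slice (d : ℕ → ℕ) (N : ℕ) (i : ∀ n, I n) : Set (∀ n, SimilaritySpace (d n) (I n)) :=
  {x | ∀ n < N, (x n).idx = i n}

/-- The points whose first `N` coordinates are `(k n, i n)`, `n < N`. -/
def cell (N : ℕ) (i : ∀ n, I n) (k : ∀ n, Fin (d n)) :
    Set (∀ n, SimilaritySpace (d n) (I n)) :=
  {x | ∀ n < N, x n = ⟨k n, i n⟩}

/-- The sequence of the first components of the coordinates of a point. -/
def rows (x : ∀ n, SimilaritySpace (d n) (I n)) : ∀ n, Fin (d n) := fun n => (x n).row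

/-- Replace the second components of the first `N` coordinates by `i 0, …, i (N - 1)`. -/
def setIdx (N : ℕ) (i : ∀ n, I n) (x : ∀ n, SimilaritySpace (d n) (I n)) :
    ∀ n, SimilaritySpace (d n) (I n) :=
  fun n => if n < N then ⟨(x n).row, i n⟩ else x n

/-- The effect of `setIdx` on the `n`-th coordinate. -/
def setIdxCoord (d : ℕ → ℕ) (N : ℕ) (i : ∀ n, I n) (n : ℕ) (y : SimilaritySpace (d n) (I n)) :
    SimilaritySpace (d n) (I n) :=
  if n < N then ⟨y.row, i n⟩ else y

theorem measurable_rows : Measurable (rows (d := d) (I := I)) :=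
  measurable_pi_lambda _ fun n =>
    (measurable_from_top (f := fun y : SimilaritySpace (d n) (I n) => y.row)).comp
      (measurable_pi_apply n)

theorem measurable_setIdx (N : ℕ) (i : ∀ n, I n) : Measurable (setIdx (d := d) N i) :=
  measurable_pi_lambda _ fun n =>
    (measurable_from_top (f := setIdxCoord d N i n)).comp (measurable_pi_apply n)

theorem slice_eq_pi (N : ℕ) (i : ∀ n, I n) :
    slice d N i = (Finset.range N : Set ℕ).pi fun n => {y | y.idx = i n} := by
  ext x; simp [slice, Set.mem_pi]

theorem cell_eq_pi (N : ℕ) (i : ∀ n, I n) (k : ∀ n, Fin (d n)) :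
    cell N i k = (Finset.range N : Set ℕ).pi fun n => {⟨k n, i n⟩} := by
  ext x; simp [cell, Set.mem_pi]

theorem measurableSet_slice (N : ℕ) (i : ∀ n, I n) : MeasurableSet (slice d N i) := by
  rw [slice_eq_pi]
  exact MeasurableSet.pi (Finset.countable_toSet _) fun n _ => MeasurableSpace.measurableSet_top

theorem measurableSet_cell (N : ℕ) (i : ∀ n, I n) (k : ∀ n, Fin (d n)) :
    MeasurableSet (cell N i k) := by
  rw [cell_eq_pi]
  exact MeasurableSet.pi (Finset.countable_toSet _) fun n _ => MeasurableSpace.measurableSet_top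

theorem setIdx_setIdx (N : ℕ) (i j : ∀ n, I n) (x : ∀ n, SimilaritySpace (d n) (I n)) :
    setIdx N i (setIdx N j x) = setIdx N i x := by
  funext n; by_cases h : n < N <;> simp [setIdx, h]

theorem setIdx_mem_slice (N : ℕ) (i : ∀ n, I n) (x : ∀ n, SimilaritySpace (d n) (I n)) :
    setIdx N i x ∈ slice d N i := fun n h => by simp [setIdx, h]

theorem rows_setIdx (N : ℕ) (i : ∀ n, I n) (x : ∀ n, SimilaritySpace (d n) (I n)) :
    rows (setIdx N i x) = rows x := by
  funext n; by_cases h : n < N <;> simp [setIdx, rows, h]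

theorem setIdx_mem_cell_iff (N : ℕ) (i : ∀ n, I n) (k : ∀ n, Fin (d n))
    (x : ∀ n, SimilaritySpace (d n) (I n)) :
    setIdx N i x ∈ cell N i k ↔ ∀ n < N, rows x n = k n := by
  refine forall_congr' fun n => imp_congr_right fun h => ?_
  simp [setIdx, h, rows, SimilaritySpace.ext_iff]

theorem mem_cell_iff (N : ℕ) (i : ∀ n, I n) (k : ∀ n, Fin (d n))
    (x : ∀ n, SimilaritySpace (d n) (I n)) :
    x ∈ cell N i k ↔ x ∈ slice d N i ∧ ∀ n < N, rows x n = k n := by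
  simp only [cell, slice, rows, Set.mem_ofPred_eq, SimilaritySpace.ext_iff]
  exact ⟨fun h => ⟨fun n hn => (h n hn).2, fun n hn => (h n hn).1⟩,
    fun h n hn => ⟨h.2 n hn, h.1 n hn⟩⟩

theorem setIdx_setRow (N : ℕ) (i : ∀ n, I n) (n : ℕ) (k : Fin (d n))
    (x : ∀ n, SimilaritySpace (d n) (I n)) :
    setIdx N i (setRow n k x) = setRow n k (setIdx N i x) := by
  funext m
  by_cases hm : m = n
  · subst hm
    by_cases h : m < N <;> simp [setIdx, setRow, h]
  · by_cases h : m < N <;> simp [setIdx, setRow, h, Function.update_of_ne hm]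

theorem setRow_mem_slice_iff (N : ℕ) (i : ∀ n, I n) (n : ℕ) (k : Fin (d n))
    (x : ∀ n, SimilaritySpace (d n) (I n)) :
    setRow n k x ∈ slice d N i ↔ x ∈ slice d N i := by
  refine forall_congr' fun m => imp_congr_right fun _ => ?_
  by_cases hm : m = n
  · subst hm; simp [setRow]
  · simp [setRow, Function.update_of_ne hm]

theorem rows_setRow (n : ℕ) (k : Fin (d n)) (x : ∀ n, SimilaritySpace (d n) (I n)) :
    rows (setRow n k x) = Function.update (rows x) n k := by
  funext m
  by_cases hm : m = n
  · subst hm; simp [rows, setRow]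
  · simp [rows, setRow, Function.update_of_ne hm]

variable (S : ∀ n, SimilaritySystem (d n) (I n))

instance : IsProbabilityMeasure (productMeasure S) := by
  unfold productMeasure; infer_instance

/-- The weight `∏ f (i n)`, `n < N`, of the slice `slice d N i`. -/
def sliceWeight (N : ℕ) (i : ∀ n, I n) : ℝ≥0 := ∏ n ∈ Finset.range N, ((S n).f (i n)).toNNReal

theorem sliceWeight_pos (N : ℕ) (i : ∀ n, I n) : 0 < sliceWeight S N i :=
  Finset.prod_pos fun n _ => Real.toNNReal_pos.2 ((S n).f_pos _)

/-- The row and the index are independent, and the index `i` has probability `f i`. -/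
theorem SimilaritySystem.measure_inter_idx {d : ℕ} {I : Type u} (S : SimilaritySystem d I)
    (i : I) (B : Set (SimilaritySpace d I)) :
    S.measure (B ∩ {y | y.idx = i}) =
      (S.f i).toNNReal * S.measure ((fun y => (⟨y.row, i⟩ : SimilaritySpace d I)) ⁻¹' B) := by
  have hd : (0 : ℝ) < d := Nat.cast_pos.2 S.d_pos
  -- The sum over all points of a function of the row times a function of the index.
  have key : ∀ (u : Fin d → ℝ≥0∞) (v : I → ℝ≥0∞),
      ∑' x : SimilaritySpace d I, u x.row * v x.idx = (∑ r, u r) * ∑' j, v j := by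
    intro u v
    calc _ = ∑' x : Fin d × I, u x.1 * v x.2 :=
          (SimilaritySpace.equivProd d I).tsum_eq fun x : Fin d × I => u x.1 * v x.2
      _ = ∑' (r : Fin d) (j : I), u r * v j := ENNReal.tsum_prod (f := fun r j => u r * v j)
      _ = _ := by simp only [ENNReal.tsum_mul_left, tsum_fintype, Finset.sum_mul]
  have h1 : ∑' j, ENNReal.ofReal (S.f j / d) = ENNReal.ofReal (1 / d) := by
    rw [← ENNReal.ofReal_tsum_of_nonneg (fun i => (div_pos (S.f_pos i) hd).le)
      (S.hasSum_f.summable.div_const _), (S.hasSum_f.div_const _).tsum_eq]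
  let u : Fin d → ℝ≥0∞ := fun r => B.indicator 1 ⟨r, i⟩
  rw [measure_apply, measure_apply]
  have h2 : ∀ x : SimilaritySpace d I,
      ENNReal.ofReal (S.f x.idx / d) * (B ∩ {y | y.idx = i}).indicator 1 x =
        u x.row * ({i} : Set I).indicator (fun j => ENNReal.ofReal (S.f j / d)) x.idx := by
    rintro ⟨r, j⟩
    by_cases hj : j = i
    · subst hj
      by_cases hB : (⟨r, j⟩ : SimilaritySpace d I) ∈ B <;> simp [u, hB]
    · simp [hj]
  have h3 : ∀ x : SimilaritySpace d I,
      ENNReal.ofReal (S.f x.idx / d) *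
          ((fun y => (⟨y.row, i⟩ : SimilaritySpace d I)) ⁻¹' B).indicator 1 x =
        u x.row * ENNReal.ofReal (S.f x.idx / d) := by
    rintro ⟨r, j⟩
    rw [mul_comm]
    rfl
  rw [tsum_congr h2, tsum_congr h3, key, key u fun j => ENNReal.ofReal (S.f j / d), h1,
    tsum_eq_single i (fun j hj => by simp [hj])]
  rw [Set.indicator_of_mem (Set.mem_singleton i), mul_left_comm, div_eq_mul_one_div,
    ENNReal.ofReal_mul (S.f_pos i).le]
  rfl

/-- Up to its weight, the restriction of the product measure to a slice is the image of the product
measure under the map which moves every point to this slice. -/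
theorem productMeasure_restrict_slice (N : ℕ) (i : ∀ n, I n) :
    (productMeasure S).restrict (slice d N i) =
      (sliceWeight S N i : ℝ≥0∞) • (productMeasure S).map (setIdx N i) := by
  have hF0 : (sliceWeight S N i : ℝ≥0∞) ≠ 0 := by exact_mod_cast (sliceWeight_pos S N i).ne'
  have hFt : (sliceWeight S N i : ℝ≥0∞) ≠ ∞ := ENNReal.coe_ne_top
  have hmeas : ∀ n, Measurable (setIdxCoord d N i n) := fun n => measurable_from_top
  have hprob : ∀ n, IsProbabilityMeasure ((S n).measure.map (setIdxCoord d N i n)) := fun n =>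
    Measure.isProbabilityMeasure_map (hmeas n).aemeasurable
  have hmap : (productMeasure S).map (setIdx N i) =
      Measure.infinitePi fun n => (S n).measure.map (setIdxCoord d N i n) :=
    Measure.infinitePi_map_pi (μ := fun n => (S n).measure) hmeas
  have hmain : (sliceWeight S N i : ℝ≥0∞)⁻¹ • (productMeasure S).restrict (slice d N i) =
      Measure.infinitePi fun n => (S n).measure.map (setIdxCoord d N i n) := by
    refine Measure.eq_infinitePi _ fun s t ht => ?_
    classical
    -- Both sides are computed as products over a finite set that contains `range N`.
    let w := s ∪ Finset.range N
    let t' : ∀ n, Set (SimilaritySpace (d n) (I n)) := fun n => if n ∈ s then t n else Set.univ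
    let b : ∀ n, Set (SimilaritySpace (d n) (I n)) := fun n =>
      if n < N then t' n ∩ {y | y.idx = i n} else t' n
    have hset : (s : Set ℕ).pi t ∩ slice d N i = (w : Set ℕ).pi b := by
      ext x
      simp only [Set.mem_inter_iff, Set.mem_pi, Finset.mem_coe, slice, Set.mem_ofPred_eq]
      constructor
      · rintro ⟨h1, h2⟩ n _
        have : x n ∈ t' n := by
          by_cases hs : n ∈ s
          · simpa [t', hs] using h1 n hs
          · simp [t', hs]
        by_cases hN : n < N
        · simpa [b, hN] using ⟨this, h2 n hN⟩
        · simpa [b, hN] using this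
      · intro h
        refine ⟨fun n hn => ?_, fun n hn => ?_⟩
        · have := h n (Finset.mem_union_left _ hn)
          by_cases hN : n < N
          · simp only [b, t', hN, hn, if_true] at this
            exact this.1
          · simpa [b, t', hN, hn] using this
        · have := h n (Finset.mem_union_right _ (Finset.mem_range.2 hn))
          simp only [b, hn, if_true] at this
          exact this.2
    have hfac : ∀ n, (S n).measure (b n) =
        (if n < N then (((S n).f (i n)).toNNReal : ℝ≥0∞) else 1) *
          (S n).measure.map (setIdxCoord d N i n) (t' n) := by
      intro n
      rw [Measure.map_apply (hmeas n) MeasurableSpace.measurableSet_top]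
      by_cases hN : n < N
      · simp only [b, hN, if_true]
        have hc : setIdxCoord d N i n = fun y => ⟨y.row, i n⟩ := by
          funext y; simp [setIdxCoord, hN]
        rw [SimilaritySystem.measure_inter_idx, hc]
      · simp only [b, hN, if_false, one_mul]
        congr 1
        ext y
        simp [setIdxCoord, hN]
    rw [Measure.smul_apply, Measure.restrict_apply
      (MeasurableSet.pi (Finset.countable_toSet s) fun n _ => ht n), hset, productMeasure,
      Measure.infinitePi_pi _ (fun n _ => MeasurableSpace.measurableSet_top),
      Finset.prod_congr rfl fun n _ => hfac n, Finset.prod_mul_distrib]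
    have h1 : ∏ n ∈ w, (if n < N then (((S n).f (i n)).toNNReal : ℝ≥0∞) else 1) =
        sliceWeight S N i := by
      rw [sliceWeight, ENNReal.ofNNReal_finsetProd, ← Finset.prod_filter]
      refine Finset.prod_congr ?_ fun _ _ => rfl
      ext n
      simpa [w] using fun h : n < N => Or.inr h
    have h2 : ∏ n ∈ w, (S n).measure.map (setIdxCoord d N i n) (t' n) =
        ∏ n ∈ s, (S n).measure.map (setIdxCoord d N i n) (t n) := by
      rw [← Finset.prod_subset (Finset.subset_union_left (s₁ := s) (s₂ := Finset.range N))]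
      · exact Finset.prod_congr rfl fun n hn => by simp [t', hn]
      · intro n _ hn
        simp [t', hn]
    rw [h1, h2, smul_eq_mul, ← mul_assoc, ENNReal.inv_mul_cancel hF0 hFt, one_mul]
  rw [hmap, ← hmain, smul_smul, ENNReal.mul_inv_cancel hF0 hFt, one_smul]

theorem map_setIdx_restrict_slice (N : ℕ) (i j : ∀ n, I n) :
    (sliceWeight S N i : ℝ≥0∞) •
        ((productMeasure S).restrict (slice d N j)).map (setIdx N i) =
      (sliceWeight S N j : ℝ≥0∞) • (productMeasure S).restrict (slice d N i) := by
  rw [productMeasure_restrict_slice, productMeasure_restrict_slice, Measure.map_smul,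
    Measure.map_map (measurable_setIdx N i) (measurable_setIdx N j), smul_comm]
  congr 3
  funext x
  exact (setIdx_setIdx N i j x)

theorem map_setIdx_restrict_cell (N : ℕ) (i j : ∀ n, I n) (k : ∀ n, Fin (d n)) :
    (sliceWeight S N i : ℝ≥0∞) •
        ((productMeasure S).restrict (cell N j k)).map (setIdx N i) =
      (sliceWeight S N j : ℝ≥0∞) • (productMeasure S).restrict (cell N i k) := by
  have h1 : ∀ j : ∀ n, I n, (productMeasure S).restrict (cell N j k) =
      ((productMeasure S).restrict (slice d N j)).restrict (setIdx N i ⁻¹' cell N i k) := by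
    intro j
    rw [Measure.restrict_restrict (measurable_setIdx N i (measurableSet_cell N i k))]
    congr 1
    ext x
    rw [Set.mem_inter_iff, Set.mem_preimage, setIdx_mem_cell_iff, mem_cell_iff, and_comm]
  have h2 : (productMeasure S).restrict (cell N i k) =
      ((productMeasure S).restrict (slice d N i)).restrict (cell N i k) := by
    rw [Measure.restrict_restrict (measurableSet_cell N i k)]
    congr 1
    ext x
    rw [Set.mem_inter_iff, mem_cell_iff]
    tauto
  rw [h1 j, h2, ← Measure.restrict_map (measurable_setIdx N i) (measurableSet_cell N i k),
    ← Measure.restrict_smul, ← Measure.restrict_smul, map_setIdx_restrict_slice]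

theorem sliceWeight_mul_measure_cell (N : ℕ) (i j : ∀ n, I n) (k : ∀ n, Fin (d n)) :
    sliceWeight S N i * productMeasure S (cell N j k) =
      sliceWeight S N j * productMeasure S (cell N i k) := by
  have h := congrArg (fun ν => ν Set.univ) (map_setIdx_restrict_cell S N i j k)
  simpa [Measure.map_apply (measurable_setIdx N i) MeasurableSet.univ] using h

theorem measure_cell_ne_zero (N : ℕ) (i : ∀ n, I n) (k : ∀ n, Fin (d n)) :
    productMeasure S (cell N i k) ≠ 0 := by
  rw [cell_eq_pi, productMeasure,
    Measure.infinitePi_pi _ (fun n _ => MeasurableSpace.measurableSet_top), Finset.prod_ne_zero_iff]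
  intro n _
  rw [SimilaritySystem.measure_apply]
  refine ne_of_gt (lt_of_lt_of_le ?_ (ENNReal.le_tsum ⟨k n, i n⟩))
  have : 0 < (S n).f (i n) / d n := div_pos ((S n).f_pos _) (Nat.cast_pos.2 (S n).d_pos)
  simpa using this

theorem map_setIdx_le (N : ℕ) (i : ∀ n, I n) :
    (productMeasure S).map (setIdx N i) ≤
      (((sliceWeight S N i)⁻¹ : ℝ≥0) : ℝ≥0∞) • productMeasure S := by
  have hF : sliceWeight S N i ≠ 0 := (sliceWeight_pos S N i).ne'
  have h : (((sliceWeight S N i)⁻¹ : ℝ≥0) : ℝ≥0∞) •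
      (productMeasure S).restrict (slice d N i) = (productMeasure S).map (setIdx N i) := by
    rw [productMeasure_restrict_slice, smul_smul, ENNReal.coe_inv hF,
      ENNReal.inv_mul_cancel (by exact_mod_cast hF) ENNReal.coe_ne_top, one_smul]
  rw [← h]
  gcongr
  exact Measure.restrict_le_self

end Slices

/-! ### Operators between slices -/

section Transfer

variable {d : ℕ → ℕ} {I : ℕ → Type u} (p : ℝ≥0∞) [Fact (1 ≤ p)]
  (S : ∀ n, SimilaritySystem (d n) (I n))

/-- The operator on `L^p` of the product which moves a function from the slice of `j` to the slice
of `i` and multiplies it there by the function `h` of the rows; the result vanishes outside the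
slice of `i`. -/
def transfer (N : ℕ) (i j : ∀ n, I n) (h : C(∀ n, Fin (d n), ℂ)) :
    Lp ℂ p (productMeasure S) →L[ℂ] Lp ℂ p (productMeasure S) :=
  weightedComp p (productMeasure S) ((slice d N i).indicator fun x => h (rows x)) (setIdx N j)
    ((h.continuous.measurable.comp measurable_rows).indicator (measurableSet_slice N i))
    ⟨‖h‖, fun x => (norm_indicator_le_norm_self _ x).trans (h.norm_coe_le_norm _)⟩
    (measurable_setIdx N j) ⟨_, map_setIdx_le S N j⟩

theorem transfer_ae (N : ℕ) (i j : ∀ n, I n) (h : C(∀ n, Fin (d n), ℂ))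
    (ξ : Lp ℂ p (productMeasure S)) :
    transfer p S N i j h ξ =ᵐ[productMeasure S]
      fun x => (slice d N i).indicator (fun x => h (rows x)) x * ξ (setIdx N j x) :=
  weightedComp_ae p _ _ _ _ _ _ _ _

theorem quasiMeasurePreserving_setIdx (N : ℕ) (i : ∀ n, I n) :
    Measure.QuasiMeasurePreserving (setIdx N i) (productMeasure S) (productMeasure S) :=
  quasiMeasurePreserving_of_map_le (measurable_setIdx N i) ⟨_, map_setIdx_le S N i⟩

theorem quasiMeasurePreserving_setRow (n : ℕ) (k : Fin (d n)) :
    Measure.QuasiMeasurePreserving (setRow n k) (productMeasure S) (productMeasure S) :=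
  quasiMeasurePreserving_of_map_le (measurable_setRow n k) ⟨d n, map_setRow_le S n k⟩

/-- The weights of the slices enter because `setIdx N j` changes the measure by their ratio. The
estimate is sharp, so that no constant depending on `N` is lost. -/
theorem norm_transfer_apply_le (N : ℕ) (i j : ∀ n, I n)
    (h : C(∀ n, Fin (d n), ℂ)) (ξ : Lp ℂ p (productMeasure S)) :
    ‖transfer p S N i j h ξ‖ ≤
      ‖h‖ * ((sliceWeight S N i / sliceWeight S N j : ℝ≥0) : ℝ) ^ (1 / p.toReal) * ‖ξ‖ := by
  have hFj : sliceWeight S N j ≠ 0 := (sliceWeight_pos S N j).ne'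
  set c : ℝ≥0 := sliceWeight S N i / sliceWeight S N j with hc
  -- Composition with `setIdx N j` maps the slice of `i` to that of `j`, up to the ratio of weights.
  have hmap : ((productMeasure S).restrict (slice d N i)).map (setIdx N j) ≤
      (c : ℝ≥0∞) • productMeasure S := by
    have h1 := map_setIdx_restrict_slice S N j i
    have h2 : ((productMeasure S).restrict (slice d N i)).map (setIdx N j) =
        (c : ℝ≥0∞) • (productMeasure S).restrict (slice d N j) := by
      rw [hc, ENNReal.coe_div hFj, div_eq_mul_inv, mul_comm, mul_smul, ← h1, smul_smul,
        ENNReal.inv_mul_cancel (by exact_mod_cast hFj) ENNReal.coe_ne_top, one_smul]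
    rw [h2]
    gcongr
    exact Measure.restrict_le_self
  have hp0 : p ≠ 0 := (zero_lt_one.trans_le (Fact.out : 1 ≤ p)).ne'
  have hq := quasiMeasurePreserving_setIdx S N j
  have hae : AEStronglyMeasurable (fun x => ξ (setIdx N j x)) (productMeasure S) :=
    (Lp.aestronglyMeasurable ξ).comp_quasiMeasurePreserving hq
  have h1 : eLpNorm (transfer p S N i j h ξ) p (productMeasure S) ≤
      ENNReal.ofReal ‖h‖ * ((c : ℝ≥0∞) ^ (1 / p).toReal * eLpNorm ξ p (productMeasure S)) := by
    calc eLpNorm (transfer p S N i j h ξ) p (productMeasure S)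
        = eLpNorm ((slice d N i).indicator fun x => h (rows x) * ξ (setIdx N j x)) p
            (productMeasure S) := by
          refine eLpNorm_congr_ae ((transfer_ae p S N i j h ξ).trans (ae_of_all _ fun x => ?_))
          simp only [Set.indicator_mul_left]
      _ = eLpNorm (fun x => h (rows x) * ξ (setIdx N j x)) p
            ((productMeasure S).restrict (slice d N i)) :=
          eLpNorm_indicator_eq_eLpNorm_restrict (measurableSet_slice N i)
      _ ≤ ENNReal.ofReal ‖h‖ * eLpNorm (fun x => ξ (setIdx N j x)) p
            ((productMeasure S).restrict (slice d N i)) := by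
          refine eLpNorm_le_mul_eLpNorm_of_ae_le_mul (ae_of_all _ fun x => ?_) p
          rw [norm_mul]
          exact mul_le_mul_of_nonneg_right (h.norm_coe_le_norm _) (norm_nonneg _)
      _ = ENNReal.ofReal ‖h‖ * eLpNorm ξ p
            (((productMeasure S).restrict (slice d N i)).map (setIdx N j)) := by
          rw [eLpNorm_map_measure _ (measurable_setIdx N j).aemeasurable]
          · rfl
          · exact (Lp.aestronglyMeasurable ξ).mono_ac
              ((Measure.absolutelyContinuous_of_le hmap).trans Measure.smul_absolutelyContinuous)
      _ ≤ _ := by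
          gcongr
          exact eLpNorm_le_of_measure_le_smul hmap
  rw [Lp.norm_def, Lp.norm_def]
  refine (ENNReal.toReal_mono ?_ h1).trans_eq ?_
  · exact ENNReal.mul_ne_top ENNReal.ofReal_ne_top (ENNReal.mul_ne_top
      (ENNReal.rpow_ne_top_of_nonneg ENNReal.toReal_nonneg ENNReal.coe_ne_top)
      (Lp.eLpNorm_ne_top ξ))
  · rw [ENNReal.toReal_mul, ENNReal.toReal_mul, ENNReal.toReal_ofReal (norm_nonneg _),
      ← ENNReal.toReal_rpow, ENNReal.coe_toReal, one_div, ENNReal.toReal_inv, one_div, mul_assoc]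

theorem transfer_mul_transfer (N : ℕ) (i j l : ∀ n, I n) (h h' : C(∀ n, Fin (d n), ℂ)) :
    transfer p S N i j h * transfer p S N j l h' = transfer p S N i l (h * h') := by
  ext1 ξ
  refine Lp.ext ?_
  rw [mul_apply_eq_comp]
  filter_upwards [transfer_ae p S N i j h (transfer p S N j l h' ξ),
    (quasiMeasurePreserving_setIdx S N j).ae (transfer_ae p S N j l h' ξ),
    transfer_ae p S N i l (h * h') ξ] with x h1 h2 h3
  rw [h1, h2, h3, setIdx_setIdx, Set.indicator_of_mem (setIdx_mem_slice N j x), rows_setIdx]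
  by_cases hx : x ∈ slice d N i
  · simp [hx, mul_assoc]
  · simp [hx]

theorem transfer_add (N : ℕ) (i j : ∀ n, I n) (h h' : C(∀ n, Fin (d n), ℂ)) :
    transfer p S N i j (h + h') = transfer p S N i j h + transfer p S N i j h' := by
  ext1 ξ
  refine Lp.ext ?_
  rw [add_apply]
  filter_upwards [transfer_ae p S N i j h ξ, transfer_ae p S N i j h' ξ,
    transfer_ae p S N i j (h + h') ξ, Lp.coeFn_add (transfer p S N i j h ξ)
      (transfer p S N i j h' ξ)] with x h1 h2 h3 h4
  rw [h3, h4, Pi.add_apply, h1, h2]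
  by_cases hx : x ∈ slice d N i
  · simp [hx, add_mul]
  · simp [hx]

/-- The quotient of the first `N` diagonal entries, at the given rows, of the matrices `s (i n)`
and `s (j n)`. -/
def entryRatio (N : ℕ) (i j : ∀ n, I n) : C(∀ n, Fin (d n), ℂ) where
  toFun r := ∏ n ∈ Finset.range N, (S n).s (i n) (r n) (r n) / (S n).s (j n) (r n) (r n)
  continuous_toFun := continuous_finsetProd _ fun n _ =>
    (continuous_of_discreteTopology
      (f := fun r : Fin (d n) => (S n).s (i n) r r / (S n).s (j n) r r)).comp (continuous_apply n)

theorem entryRatio_apply (N : ℕ) (i j : ∀ n, I n) (r : ∀ n, Fin (d n)) :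
    entryRatio S N i j r =
      ∏ n ∈ Finset.range N, (S n).s (i n) (r n) (r n) / (S n).s (j n) (r n) (r n) := rfl

theorem entryRatio_congr (N : ℕ) (i j : ∀ n, I n) {r r' : ∀ n, Fin (d n)}
    (h : ∀ n < N, r n = r' n) : entryRatio S N i j r = entryRatio S N i j r' := by
  rw [entryRatio_apply, entryRatio_apply]
  exact Finset.prod_congr rfl fun n hn => by rw [h n (Finset.mem_range.1 hn)]

variable {S}

theorem entryRatio_ne_zero (hS : ∀ n, (S n).IsDiagonal) (N : ℕ) (i j : ∀ n, I n)
    (r : ∀ n, Fin (d n)) : entryRatio S N i j r ≠ 0 := by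
  rw [entryRatio_apply]
  exact Finset.prod_ne_zero_iff.2 fun n _ =>
    div_ne_zero ((hS n).apply_ne_zero _ _) ((hS n).apply_ne_zero _ _)

theorem entryRatio_mul_entryRatio (hS : ∀ n, (S n).IsDiagonal) (N : ℕ) (i j : ∀ n, I n)
    (r : ∀ n, Fin (d n)) : entryRatio S N i j r * entryRatio S N j i r = 1 := by
  rw [entryRatio_apply, entryRatio_apply, ← Finset.prod_mul_distrib]
  refine Finset.prod_eq_one fun n _ => ?_
  have h1 := (hS n).apply_ne_zero (i n) (r n)
  have h2 := (hS n).apply_ne_zero (j n) (r n)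
  field_simp

theorem entryRatio_self (hS : ∀ n, (S n).IsDiagonal) (N : ℕ) (i : ∀ n, I n) :
    entryRatio S N i i = 1 := by
  ext r
  rw [entryRatio_apply]
  exact Finset.prod_eq_one fun n _ => div_self ((hS n).apply_ne_zero _ _)

/-- On two slices the algebra acts by representations which are similar through a diagonal
operator; `transfer` with the ratio of the two diagonals as weight intertwines them. -/
theorem transfer_entryRatio_mul_slotOp (hS : ∀ n, (S n).IsDiagonal) (N : ℕ) (i j : ∀ n, I n)
    (n : ℕ) (a : Matrix (Fin (d n)) (Fin (d n)) ℂ) :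
    transfer p S N i j (entryRatio S N i j) * slotOp p S n a =
      slotOp p S n a * transfer p S N i j (entryRatio S N i j) := by
  ext1 ξ
  refine Lp.ext ?_
  rw [mul_apply_eq_comp, mul_apply_eq_comp]
  have hrow := fun k => (quasiMeasurePreserving_setRow S n k).ae
    (transfer_ae p S N i j (entryRatio S N i j) ξ)
  filter_upwards [transfer_ae p S N i j (entryRatio S N i j) (slotOp p S n a ξ),
    (quasiMeasurePreserving_setIdx S N j).ae (slotOp_ae p S n a ξ),
    slotOp_ae p S n a (transfer p S N i j (entryRatio S N i j) ξ), ae_all_iff.2 hrow]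
    with x h1 h2 h3 h4
  have h5 : ∀ k, transfer p S N i j (entryRatio S N i j) ξ
      (Function.update x n ⟨k, (x n).idx⟩) = _ := h4
  rw [h1, h2, h3, Finset.mul_sum]
  refine Finset.sum_congr rfl fun k _ => ?_
  have h6 : Function.update (setIdx N j x) n ⟨k, (setIdx N j x n).idx⟩ =
      setIdx N j (setRow n k x) := (setIdx_setRow N j n k x).symm
  rw [h5, h6]
  by_cases hx : x ∈ slice d N i
  · rw [Set.indicator_of_mem hx, Set.indicator_of_mem ((setRow_mem_slice_iff N i n k x).2 hx),
      rows_setRow, ← mul_assoc, ← mul_assoc]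
    congr 1
    have hr : (setIdx N j x n).row = rows x n := congrFun (rows_setIdx N j x) n
    have hr' : (x n).row = rows x n := rfl
    rw [hr, hr']
    by_cases hn : n < N
    · have e1 : (setIdx N j x n).idx = j n := setIdx_mem_slice N j x n hn
      have e2 : (x n).idx = i n := hx n hn
      have e3 : ∏ m ∈ (Finset.range N).erase n,
          (S m).s (i m) (Function.update (rows x) n k m) (Function.update (rows x) n k m) /
            (S m).s (j m) (Function.update (rows x) n k m) (Function.update (rows x) n k m) =
          ∏ m ∈ (Finset.range N).erase n,
            (S m).s (i m) (rows x m) (rows x m) / (S m).s (j m) (rows x m) (rows x m) :=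
        Finset.prod_congr rfl fun m hm => by
          rw [Function.update_of_ne (Finset.ne_of_mem_erase hm)]
      rw [e1, e2, (hS n).conj_apply, (hS n).conj_apply, entryRatio_apply, entryRatio_apply,
        ← Finset.mul_prod_erase _ _ (Finset.mem_range.2 hn),
        ← Finset.mul_prod_erase _ _ (Finset.mem_range.2 hn), e3, Function.update_self]
      have n1 := (hS n).apply_ne_zero (i n) k
      have n2 := (hS n).apply_ne_zero (j n) k
      have n3 := (hS n).apply_ne_zero (j n) (rows x n)
      field_simp
    · have e1 : (setIdx N j x n).idx = (x n).idx := by simp [setIdx, hn]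
      rw [e1, mul_comm, entryRatio_congr S N i j (r := Function.update (rows x) n k)
        fun m hm => Function.update_of_ne (by omega) _ _]
  · rw [Set.indicator_of_notMem hx,
      Set.indicator_of_notMem (mt (setRow_mem_slice_iff N i n k x).1 hx)]
    simp

theorem transfer_entryRatio_mul_of_mem (hS : ∀ n, (S n).IsDiagonal) (N : ℕ) (i j : ∀ n, I n)
    {a : Lp ℂ p (productMeasure S) →L[ℂ] Lp ℂ p (productMeasure S)} (ha : a ∈ uhfAlgebra p S) :
    transfer p S N i j (entryRatio S N i j) * a =
      a * transfer p S N i j (entryRatio S N i j) := by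
  have hle : uhfAlgebra p S ≤
      Subalgebra.centralizer ℂ {transfer p S N i j (entryRatio S N i j)} := by
    refine Subalgebra.topologicalClosure_minimal (Algebra.adjoin_le ?_) ?_
    · rintro _ ⟨n, a, rfl⟩
      refine (Subalgebra.mem_centralizer_iff ℂ).2 ?_
      rintro _ rfl
      exact transfer_entryRatio_mul_slotOp p hS N i j n a
    · exact Set.isClosed_centralizer _
  exact (Subalgebra.mem_centralizer_iff ℂ).1 (hle ha) _ rfl

theorem slotOp_mem_uhfAlgebra (n : ℕ) (a : Matrix (Fin (d n)) (Fin (d n)) ℂ) :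
    slotOp p S n a ∈ uhfAlgebra p S :=
  Subalgebra.le_topologicalClosure _ (Algebra.subset_adjoin ⟨n, a, rfl⟩)

end Transfer

/-! ### Indicator functions of cells and integrals over cells -/

section Cells

variable {d : ℕ → ℕ} {I : ℕ → Type u} (p : ℝ≥0∞)
  (S : ∀ n, SimilaritySystem (d n) (I n))

/-- The indicator function of a cell, as an element of `L^p`. -/
def cellVec (N : ℕ) (i : ∀ n, I n) (k : ∀ n, Fin (d n)) : Lp ℂ p (productMeasure S) :=
  indicatorConstLp p (measurableSet_cell N i k) (measure_ne_top _ _) 1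

theorem cellVec_ae (N : ℕ) (i : ∀ n, I n) (k : ∀ n, Fin (d n)) :
    cellVec p S N i k =ᵐ[productMeasure S] (cell N i k).indicator fun _ => 1 :=
  indicatorConstLp_coeFn

variable [Fact (1 ≤ p)]

theorem norm_cellVec (hp : p ≠ ∞) (N : ℕ) (i : ∀ n, I n) (k : ∀ n, Fin (d n)) :
    ‖cellVec p S N i k‖ = (productMeasure S).real (cell N i k) ^ (1 / p.toReal) := by
  rw [cellVec, norm_indicatorConstLp (zero_lt_one.trans_le (Fact.out : 1 ≤ p)).ne' hp]
  simp

/-- The integral over a cell, as a bounded functional on `L^p`. -/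
def cellInt (N : ℕ) (i : ∀ n, I n) (k : ∀ n, Fin (d n)) : Lp ℂ p (productMeasure S) →L[ℂ] ℂ :=
  LinearMap.mkContinuous
    { toFun := fun η => ∫ x in cell N i k, η x ∂productMeasure S
      map_add' := fun η ζ => by
        have hη := ((Lp.memLp η).integrable Fact.out).integrableOn (s := cell N i k)
        have hζ := ((Lp.memLp ζ).integrable Fact.out).integrableOn (s := cell N i k)
        rw [← integral_add hη hζ]
        exact integral_congr_ae (ae_restrict_of_ae (Lp.coeFn_add η ζ))
      map_smul' := fun c η => by
        rw [RingHom.id_apply, ← integral_smul]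
        exact integral_congr_ae (ae_restrict_of_ae (Lp.coeFn_smul c η)) }
    ((productMeasure S).real (cell N i k) ^ (1 - 1 / p.toReal)) (fun η => by
      have h1 : eLpNorm η 1 ((productMeasure S).restrict (cell N i k)) ≤
          eLpNorm η p (productMeasure S) *
            productMeasure S (cell N i k) ^ (1 - 1 / p.toReal) := by
        refine (eLpNorm_le_eLpNorm_mul_rpow_measure_univ (Fact.out : 1 ≤ p)
          (Lp.aestronglyMeasurable η).restrict).trans ?_
        rw [Measure.restrict_apply_univ, ENNReal.toReal_one, div_one]
        gcongr
        exact Measure.restrict_le_self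
      have h2 : 0 ≤ 1 - 1 / p.toReal := by
        rcases eq_or_ne p ∞ with rfl | hp
        · simp
        · have : 1 ≤ p.toReal := by
            simpa using ENNReal.toReal_mono hp (Fact.out : 1 ≤ p)
          rw [sub_nonneg]
          exact div_le_one_of_le₀ this (by positivity)
      refine (norm_integral_le_lintegral_norm _).trans ?_
      simp only [ofReal_norm]
      rw [← eLpNorm_one_eq_lintegral_enorm]
      refine (ENNReal.toReal_mono (ENNReal.mul_ne_top (Lp.eLpNorm_ne_top η)
        (ENNReal.rpow_ne_top_of_nonneg h2 (measure_ne_top _ _))) h1).trans_eq ?_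
      rw [ENNReal.toReal_mul, ← ENNReal.toReal_rpow, Lp.norm_def, mul_comm]
      rfl)

theorem cellInt_apply (N : ℕ) (i : ∀ n, I n) (k : ∀ n, Fin (d n))
    (η : Lp ℂ p (productMeasure S)) :
    cellInt p S N i k η = ∫ x in cell N i k, η x ∂productMeasure S := rfl

theorem norm_cellInt_le (N : ℕ) (i : ∀ n, I n) (k : ∀ n, Fin (d n)) :
    ‖cellInt p S N i k‖ ≤ (productMeasure S).real (cell N i k) ^ (1 - 1 / p.toReal) :=
  LinearMap.mkContinuous_norm_le _ (Real.rpow_nonneg measureReal_nonneg _) _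

theorem cellInt_cellVec (N : ℕ) (i : ∀ n, I n) (k : ∀ n, Fin (d n)) :
    cellInt p S N i k (cellVec p S N i k) = (productMeasure S).real (cell N i k) := by
  rw [cellInt_apply, integral_congr_ae (ae_restrict_of_ae (cellVec_ae p S N i k)),
    setIntegral_indicator (measurableSet_cell N i k)]
  simp

/-- On a cell the ratio of the entries is constant. -/
theorem transfer_cellVec (N : ℕ) (i j : ∀ n, I n) (k : ∀ n, Fin (d n)) :
    transfer p S N i j (entryRatio S N i j) (cellVec p S N j k) =
      entryRatio S N i j k • cellVec p S N i k := by
  refine Lp.ext ?_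
  filter_upwards [transfer_ae p S N i j (entryRatio S N i j) (cellVec p S N j k),
    (quasiMeasurePreserving_setIdx S N j).ae (cellVec_ae p S N j k), cellVec_ae p S N i k,
    Lp.coeFn_smul (entryRatio S N i j k) (cellVec p S N i k)] with x h1 h2 h3 h4
  rw [h1, h2, h4, Pi.smul_apply, h3]
  by_cases hx : x ∈ slice d N i
  · by_cases hr : ∀ n < N, rows x n = k n
    · have hc := (mem_cell_iff N i k x).2 ⟨hx, hr⟩
      have hc' := (setIdx_mem_cell_iff N j k x).2 hr
      simp [hx, hc, hc', entryRatio_congr S N i j hr]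
    · have hc := mt (fun h => ((mem_cell_iff N i k x).1 h).2) hr
      have hc' := mt (setIdx_mem_cell_iff N j k x).1 hr
      simp [hc, hc']
  · have hc := mt (fun h => ((mem_cell_iff N i k x).1 h).1) hx
    simp [hx, hc]

theorem cellInt_transfer (N : ℕ) (i j : ∀ n, I n) (k : ∀ n, Fin (d n))
    (η : Lp ℂ p (productMeasure S)) :
    (sliceWeight S N i : ℂ) * cellInt p S N j k (transfer p S N j i (entryRatio S N j i) η) =
      entryRatio S N j i k * ((sliceWeight S N j : ℂ) * cellInt p S N i k η) := by
  have hq := quasiMeasurePreserving_setIdx S N i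
  have h1 : cellInt p S N j k (transfer p S N j i (entryRatio S N j i) η) =
      entryRatio S N j i k * ∫ x in cell N j k, η (setIdx N i x) ∂productMeasure S := by
    rw [cellInt_apply, ← integral_const_mul]
    refine integral_congr_ae ?_
    filter_upwards [ae_restrict_of_ae (transfer_ae p S N j i (entryRatio S N j i) η),
      ae_restrict_mem (measurableSet_cell N j k)] with x h1 h2
    have h3 := (mem_cell_iff N j k x).1 h2
    rw [h1, Set.indicator_of_mem h3.1, entryRatio_congr S N j i h3.2]
  have hac : ((productMeasure S).restrict (cell N j k)).map (setIdx N i) ≪ productMeasure S :=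
    ((Measure.absolutelyContinuous_of_le Measure.restrict_le_self).map
      (measurable_setIdx N i)).trans hq.2
  have h2 : ∫ x in cell N j k, η (setIdx N i x) ∂productMeasure S =
      ∫ y, η y ∂((productMeasure S).restrict (cell N j k)).map (setIdx N i) :=
    (integral_map (measurable_setIdx N i).aemeasurable
      ((Lp.aestronglyMeasurable η).mono_ac hac)).symm
  have h3 := congrArg (fun ν => ∫ y, η y ∂ν) (map_setIdx_restrict_cell S N i j k)
  simp only [integral_smul_measure, ENNReal.coe_toReal] at h3
  rw [h1, h2, cellInt_apply, mul_left_comm]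
  exact congrArg _ h3

/-- The matrix unit at `(v, k n)` in the `n`-th factor moves the indicator function of a cell of a
slice on which the matrices `s` are trivial to that of another cell. -/
theorem slotOp_single_cellVec {N n : ℕ} (hn : n < N) {i : ∀ n, I n} (hi : (S n).s (i n) = 1)
    (k : ∀ n, Fin (d n)) (v : Fin (d n)) :
    slotOp p S n (Matrix.single v (k n) 1) (cellVec p S N i k) =
      cellVec p S N i (Function.update k n v) := by
  refine Lp.ext ?_
  have hrow := fun l => (quasiMeasurePreserving_setRow S n l).ae (cellVec_ae p S N i k)
  filter_upwards [slotOp_ae p S n (Matrix.single v (k n) 1) (cellVec p S N i k),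
    cellVec_ae p S N i (Function.update k n v), ae_all_iff.2 hrow] with x h1 h2 h3
  have h4 : ∀ l, cellVec p S N i k (Function.update x n ⟨l, (x n).idx⟩) = _ := h3
  simp only [h1, h2, h4]
  by_cases hx : x ∈ slice d N i
  · have e : (x n).idx = i n := hx n hn
    rw [e, (S n).conj_eq_self_of_eq_one hi, Finset.sum_eq_single (k n)]
    · have hiff : ((x n).row = v ∧ setRow n (k n) x ∈ cell N i k) ↔
          x ∈ cell N i (Function.update k n v) := by
        rw [mem_cell_iff, mem_cell_iff, setRow_mem_slice_iff, rows_setRow]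
        constructor
        · rintro ⟨rfl, -, h⟩
          refine ⟨hx, fun m hm => ?_⟩
          by_cases hmn : m = n
          · subst hmn; simp [rows]
          · simpa [Function.update_of_ne hmn] using h m hm
        · rintro ⟨-, h⟩
          refine ⟨by simpa [rows] using h n hn, hx, fun m hm => ?_⟩
          by_cases hmn : m = n
          · subst hmn; simp
          · simpa [Function.update_of_ne hmn] using h m hm
      by_cases hv : (x n).row = v
      · by_cases hc : setRow n (k n) x ∈ cell N i k
        · rw [Set.indicator_of_mem hc, Set.indicator_of_mem (hiff.1 ⟨hv, hc⟩)]
          simp [hv]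
        · rw [Set.indicator_of_notMem hc,
            Set.indicator_of_notMem fun h => hc (hiff.2 h).2]
          simp
      · rw [Set.indicator_of_notMem fun h => hv (hiff.2 h).1, Matrix.single_apply_of_ne,
          zero_mul]
        exact fun h => hv h.1.symm
    · intro l _ hl
      rw [Matrix.single_apply_of_ne, zero_mul]
      exact fun h => hl h.2.symm
    · simp
  · rw [Set.indicator_of_notMem fun h => hx ((mem_cell_iff _ _ _ _).1 h).1]
    refine Finset.sum_eq_zero fun l _ => ?_
    rw [Set.indicator_of_notMem, mul_zero]
    exact fun h => hx ((setRow_mem_slice_iff N i n l x).1 ((mem_cell_iff _ _ _ _).1 h).1)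

theorem cellInt_slotOp_single {N n : ℕ} (hn : n < N) {i : ∀ n, I n} (hi : (S n).s (i n) = 1)
    (k : ∀ n, Fin (d n)) (v : Fin (d n)) (η : Lp ℂ p (productMeasure S)) :
    cellInt p S N i (Function.update k n v) (slotOp p S n (Matrix.single v (k n) 1) η) =
      cellInt p S N i k η := by
  -- A measure-preserving transformation that agrees with `setRow n (k n)` on the new cell.
  let e : ∀ m, Equiv.Perm (Fin (d m)) := Function.update (fun _ => 1) n (Equiv.swap v (k n))
  let g : (∀ m, SimilaritySpace (d m) (I m)) → ∀ m, SimilaritySpace (d m) (I m) :=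
    fun x m => ⟨e m (x m).row, (x m).idx⟩
  have hg : Measurable g := measurable_pi_lambda _ fun m =>
    (measurable_from_top (f := fun y : SimilaritySpace (d m) (I m) =>
      (⟨e m y.row, y.idx⟩ : SimilaritySpace (d m) (I m)))).comp (measurable_pi_apply m)
  have hmap : (productMeasure S).map g = productMeasure S := by
    have := Measure.infinitePi_map_pi (μ := fun m => (S m).measure)
      (f := fun m (y : SimilaritySpace (d m) (I m)) =>
        (⟨e m y.row, y.idx⟩ : SimilaritySpace (d m) (I m))) (fun m => measurable_from_top)
    simp only [SimilaritySystem.map_measure_perm] at this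
    exact this
  have hpre : g ⁻¹' cell N i k = cell N i (Function.update k n v) := by
    ext x
    refine forall_congr' fun m => imp_congr_right fun _ => ?_
    by_cases hm : m = n
    · subst hm
      simp only [g, e, SimilaritySpace.ext_iff, Function.update_self]
      rw [Equiv.swap_apply_eq_iff, Equiv.swap_apply_right]
    · simp [g, e, Function.update_of_ne hm, SimilaritySpace.ext_iff]
  have hgx : ∀ x ∈ cell N i (Function.update k n v), setRow n (k n) x = g x := by
    intro x hx
    funext m
    by_cases hm : m = n
    · subst hm
      have := hx m hn
      simp only [Function.update_self] at this
      simp [g, e, setRow, this]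
    · simp [g, e, setRow, Function.update_of_ne hm]
  rw [cellInt_apply, cellInt_apply]
  have hint : ∫ x in cell N i k, η x ∂productMeasure S =
      ∫ x in cell N i (Function.update k n v), η (g x) ∂productMeasure S := by
    have h := setIntegral_map (μ := productMeasure S) (g := g) (f := η)
      (measurableSet_cell N i k) (by rw [hmap]; exact Lp.aestronglyMeasurable η) hg.aemeasurable
    rwa [hmap, hpre] at h
  rw [hint]
  refine integral_congr_ae ?_
  filter_upwards [ae_restrict_of_ae (slotOp_ae p S n (Matrix.single v (k n) 1) η),
    ae_restrict_mem (measurableSet_cell N i (Function.update k n v))] with x h1 h2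
  have h3 := h2 n hn
  rw [Function.update_self] at h3
  have h4 : Function.update x n ⟨k n, (x n).idx⟩ = g x := hgx x h2
  rw [h1, Finset.sum_eq_single (k n), h4, h3, (S n).conj_eq_self_of_eq_one hi]
  · simp
  · intro l _ hl
    rw [h3, (S n).conj_eq_self_of_eq_one hi, Matrix.single_apply_of_ne, zero_mul]
    exact fun h => hl h.2.symm
  · simp

end Cells

/-! ### Averaging of operators over an amenable algebra -/

section Averaging

set_option maxSynthPendingDepth 3

variable {E : Type u} [NormedAddCommGroup E] [NormedSpace ℂ E]

/-- The bilinear form `(a, b) ↦ ω (a T b ξ)` on an algebra of operators. -/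
def coeffForm (B : Subalgebra ℂ (E →L[ℂ] E)) (ω : E →L[ℂ] ℂ) (T : E →L[ℂ] E) (ξ : E) :
    B →L[ℂ] B →L[ℂ] ℂ :=
  LinearMap.mkContinuous₂
    (LinearMap.mk₂ ℂ (fun a b : B => ω (a.1 (T (b.1 ξ)))) (fun a a' b => by simp)
      (fun c a b => by simp) (fun a b b' => by simp) (fun c a b => by simp))
    (‖ω‖ * ‖T‖ * ‖ξ‖) (fun a b => by
      rw [LinearMap.mk₂_apply]
      calc ‖ω (a.1 (T (b.1 ξ)))‖ ≤ ‖ω‖ * (‖a.1‖ * (‖T‖ * (‖b.1‖ * ‖ξ‖))) := by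
            refine (ω.le_opNorm _).trans ?_
            gcongr
            refine (a.1.le_opNorm _).trans ?_
            gcongr
            refine (T.le_opNorm _).trans ?_
            gcongr
            exact b.1.le_opNorm _
        _ = ‖ω‖ * ‖T‖ * ‖ξ‖ * ‖a‖ * ‖b‖ := by
            rw [show ‖a‖ = ‖a.1‖ from rfl, show ‖b‖ = ‖b.1‖ from rfl]
            ring)

@[simp] theorem coeffForm_apply (B : Subalgebra ℂ (E →L[ℂ] E)) (ω : E →L[ℂ] ℂ) (T : E →L[ℂ] E)
    (ξ : E) (a b : B) : coeffForm B ω T ξ a b = ω (a.1 (T (b.1 ξ))) := rfl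

theorem norm_coeffForm_le (B : Subalgebra ℂ (E →L[ℂ] E)) (ω : E →L[ℂ] ℂ) (T : E →L[ℂ] E)
    (ξ : E) : ‖coeffForm B ω T ξ‖ ≤ ‖ω‖ * ‖T‖ * ‖ξ‖ :=
  LinearMap.mkContinuous₂_norm_le _ (by positivity) _

/-- Matrix coefficients `coeff ω T ξ` of the averages `∑ aₖ T bₖ` of operators `T` with respect to
a (virtual) diagonal `∑ aₖ ⊗ bₖ` of the algebra `B`; `bound` is a bound for the norm of the
diagonal. -/
structure Averaging (B : Subalgebra ℂ (E →L[ℂ] E)) where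
  coeff : (E →L[ℂ] ℂ) → (E →L[ℂ] E) → E → ℂ
  bound : ℝ
  bound_nonneg : 0 ≤ bound
  norm_le : ∀ ω T ξ, ‖coeff ω T ξ‖ ≤ bound * (‖ω‖ * ‖T‖ * ‖ξ‖)
  smul_left : ∀ (c : ℂ) ω T ξ, coeff (c • ω) T ξ = c * coeff ω T ξ
  add_middle : ∀ ω T T' ξ, coeff ω (T + T') ξ = coeff ω T ξ + coeff ω T' ξ
  smul_right : ∀ (c : ℂ) ω T ξ, coeff ω T (c • ξ) = c * coeff ω T ξ
  coeff_one : ∀ ω ξ, coeff ω 1 ξ = ω ξ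
  /-- The averages commute with the algebra. -/
  comp_left_of_mem : ∀ ω T ξ, ∀ x ∈ B, coeff (ω.comp x) T ξ = coeff ω T (x ξ)
  /-- Averaging is linear over the commutant from the left. -/
  comp_left_of_commute : ∀ ω T ξ (Q : E →L[ℂ] E), (∀ b ∈ B, Q * b = b * Q) →
    coeff (ω.comp Q) T ξ = coeff ω (Q * T) ξ
  /-- Averaging is linear over the commutant from the right. -/
  apply_right_of_commute : ∀ ω T ξ (Q : E →L[ℂ] E), (∀ b ∈ B, Q * b = b * Q) →
    coeff ω T (Q ξ) = coeff ω (T * Q) ξ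

/-- The average of `T` is the virtual diagonal applied to the forms `(a, b) ↦ ω (a T b ξ)`. -/
theorem IsAmenable.nonempty_averaging {B : Subalgebra ℂ (E →L[ℂ] E)} (h : IsAmenable B) :
    Nonempty (Averaging B) := by
  obtain ⟨V, C, hC, hVC, hV, hV1⟩ := h.exists_virtualDiagonal
  refine ⟨⟨fun ω T ξ => V (coeffForm B ω T ξ), C, hC, fun ω T ξ => ?_,
    fun c ω T ξ => ?_, fun ω T T' ξ => ?_, fun c ω T ξ => ?_, fun ω ξ => ?_, fun ω T ξ x hx => ?_,
    fun ω T ξ Q hQ => ?_, fun ω T ξ Q hQ => ?_⟩⟩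
  · exact (hVC _).trans (mul_le_mul_of_nonneg_left (norm_coeffForm_le B ω T ξ) hC)
  · rw [← smul_eq_mul, ← map_smul]
    congr 1
  · rw [← map_add]
    congr 1
    ext a b
    simp
  · rw [← smul_eq_mul, ← map_smul]
    congr 1
    ext a b
    simp
  · let f : B →L[ℂ] ℂ :=
      ω.comp ((ContinuousLinearMap.apply ℂ E ξ).comp B.toSubmodule.subtypeL)
    have h1 : coeffForm B ω 1 ξ = mulForm B f := by
      ext a b
      rfl
    rw [h1, hV1]
    rfl
  · have h1 : coeffForm B (ω.comp x) T ξ = formMulLeft B ⟨x, hx⟩ (coeffForm B ω T ξ) := by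
      ext a b
      rfl
    have h2 : coeffForm B ω T (x ξ) = formMulRight B ⟨x, hx⟩ (coeffForm B ω T ξ) := by
      ext a b
      rfl
    exact (congrArg V h1).trans ((hV _ _).trans (congrArg V h2).symm)
  · congr 1
    ext a b
    have := congrArg (fun R => R (T (b.1 ξ))) (hQ a.1 a.2)
    simpa using congrArg ω this
  · congr 1
    ext a b
    have := congrArg (fun R => R ξ) (hQ b.1 b.2)
    simpa using congrArg (fun η => ω (a.1 (T η))) this.symm

end Averaging

/-! ### Averages of multiplication operators -/

section CellCoeff

variable {d : ℕ → ℕ} {I : ℕ → Type u} (p : ℝ≥0∞) [Fact (1 ≤ p)]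
  {S : ∀ n, SimilaritySystem (d n) (I n)} (Φ : Averaging (uhfAlgebra p S))

/-- The matrix coefficient, with respect to a cell, of the average of the operator of
multiplication by the function `g` of the rows on the slice of the cell. -/
def cellCoeff (N : ℕ) (i : ∀ n, I n) (k : ∀ n, Fin (d n)) (g : C(∀ n, Fin (d n), ℂ)) : ℂ :=
  Φ.coeff (cellInt p S N i k) (transfer p S N i i g) (cellVec p S N i k)

theorem cellCoeff_add (N : ℕ) (i : ∀ n, I n) (k : ∀ n, Fin (d n))
    (g g' : C(∀ n, Fin (d n), ℂ)) :
    cellCoeff p Φ N i k (g + g') = cellCoeff p Φ N i k g + cellCoeff p Φ N i k g' := by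
  rw [cellCoeff, transfer_add, Φ.add_middle]
  rfl

theorem cellCoeff_one (hS : ∀ n, (S n).IsDiagonal) (N : ℕ) (i : ∀ n, I n)
    (k : ∀ n, Fin (d n)) :
    cellCoeff p Φ N i k 1 = (productMeasure S).real (cell N i k) := by
  have h1 := Φ.apply_right_of_commute (cellInt p S N i k) 1 (cellVec p S N i k)
    (transfer p S N i i (entryRatio S N i i))
    fun b hb => transfer_entryRatio_mul_of_mem p hS N i i hb
  rw [transfer_cellVec, entryRatio_self hS, ContinuousMap.one_apply, one_smul, Φ.coeff_one,
    one_mul, cellInt_cellVec] at h1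
  exact h1.symm

theorem entryRatio_mul_cellCoeff (hS : ∀ n, (S n).IsDiagonal) (N : ℕ) (i j : ∀ n, I n)
    (k : ∀ n, Fin (d n)) (g : C(∀ n, Fin (d n), ℂ)) :
    entryRatio S N i j k * cellCoeff p Φ N i k g =
      Φ.coeff (cellInt p S N i k) (transfer p S N i j (g * entryRatio S N i j))
        (cellVec p S N j k) := by
  rw [cellCoeff, ← Φ.smul_right, ← transfer_cellVec, Φ.apply_right_of_commute _ _ _ _
    fun b hb => transfer_entryRatio_mul_of_mem p hS N i j hb, transfer_mul_transfer]

/-- Up to normalization, `cellCoeff` does not depend on the slice: conjugation by a diagonal matrix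
does not change diagonal entries. -/
theorem sliceWeight_mul_cellCoeff (hS : ∀ n, (S n).IsDiagonal) (N : ℕ) (i j : ∀ n, I n)
    (k : ∀ n, Fin (d n)) (g : C(∀ n, Fin (d n), ℂ)) :
    (sliceWeight S N i : ℂ) * cellCoeff p Φ N j k g =
      (sliceWeight S N j : ℂ) * cellCoeff p Φ N i k g := by
  refine mul_left_cancel₀ (entryRatio_ne_zero hS N j i k) ?_
  have h1 : (sliceWeight S N i : ℂ) •
      (cellInt p S N j k).comp (transfer p S N j i (entryRatio S N j i)) =
      (entryRatio S N j i k * (sliceWeight S N j : ℂ)) • cellInt p S N i k := by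
    ext η
    simpa [mul_assoc] using cellInt_transfer p S N i j k η
  rw [mul_left_comm, entryRatio_mul_cellCoeff p Φ hS N j i, mul_comm g,
    ← transfer_mul_transfer p S N j i i, ← Φ.comp_left_of_commute _ _ _ _
    fun b hb => transfer_entryRatio_mul_of_mem p hS N j i hb, ← Φ.smul_left, h1, Φ.smul_left,
    mul_assoc]
  rfl

/-- The diagonal coefficient is computed with `g * entryRatio S N i j` as an operator from the slice
of `j` to that of `i`, whose norm is governed by the supremum of this function. -/
theorem norm_cellCoeff_le (hp : p ≠ ∞) (hS : ∀ n, (S n).IsDiagonal) (N : ℕ) (i j : ∀ n, I n)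
    (k : ∀ n, Fin (d n)) (g : C(∀ n, Fin (d n), ℂ)) :
    ‖cellCoeff p Φ N i k g‖ ≤ Φ.bound *
      (‖g * entryRatio S N i j‖ * ‖entryRatio S N i j k‖⁻¹ *
        (productMeasure S).real (cell N i k)) := by
  set Mi := (productMeasure S).real (cell N i k) with hMi
  set Mj := (productMeasure S).real (cell N j k) with hMj
  set c : ℝ := ((sliceWeight S N i / sliceWeight S N j : ℝ≥0) : ℝ) with hc
  have hMi0 : 0 < Mi := ENNReal.toReal_pos (measure_cell_ne_zero S N i k) (measure_ne_top _ _)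
  have hFj : (sliceWeight S N j : ℝ) ≠ 0 := by exact_mod_cast (sliceWeight_pos S N j).ne'
  have hcM : c * Mj = Mi := by
    have h := congrArg ENNReal.toReal (sliceWeight_mul_measure_cell S N i j k)
    rw [ENNReal.toReal_mul, ENNReal.toReal_mul, ENNReal.coe_toReal, ENNReal.coe_toReal] at h
    have h' : (sliceWeight S N i : ℝ) * Mj = sliceWeight S N j * Mi := h
    rw [hc, NNReal.coe_div, div_mul_eq_mul_div, h', mul_div_cancel_left₀ _ hFj]
  have hT : ‖transfer p S N i j (g * entryRatio S N i j)‖ ≤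
      ‖g * entryRatio S N i j‖ * c ^ (1 / p.toReal) :=
    ContinuousLinearMap.opNorm_le_bound _ (by positivity)
      (norm_transfer_apply_le p S N i j _)
  have hr : 0 < ‖entryRatio S N i j k‖ := norm_pos_iff.2 (entryRatio_ne_zero hS N i j k)
  have h1 : ‖entryRatio S N i j k‖ * ‖cellCoeff p Φ N i k g‖ ≤
      Φ.bound * ‖g * entryRatio S N i j‖ * Mi := by
    rw [← norm_mul, entryRatio_mul_cellCoeff p Φ hS]
    calc _ ≤ Φ.bound * (Mi ^ (1 - 1 / p.toReal) *
          (‖g * entryRatio S N i j‖ * c ^ (1 / p.toReal)) * Mj ^ (1 / p.toReal)) := by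
          refine (Φ.norm_le _ _ _).trans (mul_le_mul_of_nonneg_left ?_ Φ.bound_nonneg)
          rw [norm_cellVec p S hp]
          gcongr
          exact norm_cellInt_le p S N i k
      _ = Φ.bound * ‖g * entryRatio S N i j‖ *
          (Mi ^ (1 - 1 / p.toReal) * (c * Mj) ^ (1 / p.toReal)) := by
          rw [Real.mul_rpow (NNReal.coe_nonneg _) measureReal_nonneg]
          ring
      _ = _ := by rw [hcM, ← Real.rpow_add hMi0, sub_add_cancel, Real.rpow_one]
  rw [mul_right_comm, ← mul_assoc, ← mul_assoc, ← div_eq_mul_inv, le_div_iff₀ hr, mul_comm]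
  exact h1

/-- The estimate `norm_cellCoeff_le`, transported to the slice of `j`. -/
theorem norm_cellCoeff_le' (hp : p ≠ ∞) (hS : ∀ n, (S n).IsDiagonal) (N : ℕ) (i j : ∀ n, I n)
    (k : ∀ n, Fin (d n)) (g : C(∀ n, Fin (d n), ℂ)) :
    ‖cellCoeff p Φ N j k g‖ ≤ Φ.bound *
      (‖g * entryRatio S N i j‖ * ‖entryRatio S N i j k‖⁻¹ *
        (productMeasure S).real (cell N j k)) := by
  have hFi : 0 < (sliceWeight S N i : ℝ) := by exact_mod_cast sliceWeight_pos S N i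
  have h1 := congrArg norm (sliceWeight_mul_cellCoeff p Φ hS N i j k g)
  rw [norm_mul, norm_mul, Complex.norm_of_nonneg (by positivity : (0 : ℝ) ≤ sliceWeight S N i),
    Complex.norm_of_nonneg (by positivity : (0 : ℝ) ≤ sliceWeight S N j)] at h1
  have h2 := congrArg ENNReal.toReal (sliceWeight_mul_measure_cell S N i j k)
  rw [ENNReal.toReal_mul, ENNReal.toReal_mul, ENNReal.coe_toReal, ENNReal.coe_toReal] at h2
  refine le_of_mul_le_mul_left ?_ hFi
  rw [h1, mul_left_comm, mul_left_comm (sliceWeight S N i : ℝ), Measure.real, h2,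
    mul_left_comm _ (sliceWeight S N j : ℝ), mul_left_comm _ (sliceWeight S N j : ℝ)]
  exact mul_le_mul_of_nonneg_left (norm_cellCoeff_le p Φ hp hS N i j k g) (NNReal.coe_nonneg _)

end CellCoeff

/-! ### The lower bound for the norm of a diagonal -/

section Bound

variable {d : ℕ → ℕ} {I : ℕ → Type u} (p : ℝ≥0∞) [Fact (1 ≤ p)]
  {S : ∀ n, SimilaritySystem (d n) (I n)} (Φ : Averaging (uhfAlgebra p S))

/-- On a slice where all matrices `s` are trivial, `cellCoeff` does not depend on the cell, because
matrix units move one cell to another and commute with averages. -/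
theorem cellCoeff_eq_cellCoeff (N : ℕ) {o : ∀ n, I n} (ho : ∀ n, (S n).s (o n) = 1)
    (k k' : ∀ n, Fin (d n)) (g : C(∀ n, Fin (d n), ℂ)) :
    cellCoeff p Φ N o k g = cellCoeff p Φ N o k' g := by
  have step : ∀ n < N, ∀ (k : ∀ n, Fin (d n)) (v : Fin (d n)),
      cellCoeff p Φ N o k g = cellCoeff p Φ N o (Function.update k n v) g := by
    intro n hn k v
    have h1 : cellInt p S N o k = (cellInt p S N o (Function.update k n v)).comp
        (slotOp p S n (Matrix.single v (k n) 1)) := by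
      ext η
      exact (cellInt_slotOp_single p S hn (ho n) k v η).symm
    rw [cellCoeff, h1, Φ.comp_left_of_mem _ _ _ _ (slotOp_mem_uhfAlgebra p n _),
      slotOp_single_cellVec p S hn (ho n) k v]
    rfl
  -- The first `M` entries of `k` are replaced by those of `k'`.
  have key : ∀ M ≤ N, cellCoeff p Φ N o k g =
      cellCoeff p Φ N o (fun n => if n < M then k' n else k n) g := by
    intro M
    induction M with
    | zero => intro _; simp
    | succ M ih =>
      intro hM
      rw [ih (Nat.le_of_succ_le hM), step M hM _ (k' M)]
      congr 2
      funext n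
      rcases lt_trichotomy n M with h | rfl | h
      · simp [Function.update_of_ne h.ne, h, Nat.lt_succ_of_lt h]
      · simp
      · rw [Function.update_of_ne h.ne', if_neg (by omega), if_neg (by omega)]
  rw [key N le_rfl]
  have hcell : cell N o (fun n => if n < N then k' n else k n) = cell N o k' := by
    ext x
    exact forall_congr' fun n => imp_congr_right fun hn => by simp [hn]
  have hform : ∀ k₁ : ∀ n, Fin (d n), cell N o k₁ = cell N o k' →
      cellCoeff p Φ N o k₁ g = cellCoeff p Φ N o k' g := by
    intro k₁ h
    have h1 : cellInt p S N o k₁ = cellInt p S N o k' := by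
      ext η
      rw [cellInt_apply, cellInt_apply, h]
    have h2 : cellVec p S N o k₁ = cellVec p S N o k' := by
      simp only [cellVec, h]
    rw [cellCoeff, h1, h2]
    rfl
  rw [hform _ hcell]

/-- The norm of a virtual diagonal bounds the quotient of any two products of diagonal entries of
the matrices `s (i n)`, uniformly in the number of factors. -/
theorem norm_entryRatio_le (hp : p ≠ ∞) (hS : ∀ n, (S n).IsDiagonal)
    (N : ℕ) (i : ∀ n, I n) {o : ∀ n, I n} (ho : ∀ n, (S n).s (o n) = 1)
    (k k' : ∀ n, Fin (d n)) :
    ‖entryRatio S N i o k'‖ ≤ 4 * Φ.bound ^ 2 * ‖entryRatio S N i o k‖ := by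
  set q := entryRatio S N i o with hq
  have hq0 : ∀ r, 0 < ‖q r‖ := fun r => norm_pos_iff.2 (entryRatio_ne_zero hS N i o r)
  have hqinv : ∀ r, ‖entryRatio S N o i r‖ = ‖q r‖⁻¹ := fun r => by
    have h := congrArg norm (entryRatio_mul_entryRatio hS N o i r)
    rw [norm_mul, norm_one] at h
    exact eq_inv_of_mul_eq_one_left h
  -- Splitting `1 = g + (1 - g)` so that both `g / q` and `(1 - g) * q` are bounded; the geometric
  -- mean `m` balances the two bounds.
  set m := √(‖q k‖ * ‖q k'‖) with hm
  have hm0 : 0 < m := Real.sqrt_pos.2 (mul_pos (hq0 k) (hq0 k'))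
  have hden : ∀ r, ((‖q r‖ + m : ℝ) : ℂ) ≠ 0 := fun r => by
    exact_mod_cast (add_pos (hq0 r) hm0).ne'
  let g : C(∀ n, Fin (d n), ℂ) :=
    ⟨fun r => ((‖q r‖ : ℝ) : ℂ) / ((‖q r‖ + m : ℝ) : ℂ),
      (Complex.continuous_ofReal.comp q.continuous.norm).div
        (Complex.continuous_ofReal.comp (q.continuous.norm.add continuous_const)) hden⟩
  let g' : C(∀ n, Fin (d n), ℂ) :=
    ⟨fun r => (m : ℂ) / ((‖q r‖ + m : ℝ) : ℂ),
      continuous_const.div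
        (Complex.continuous_ofReal.comp (q.continuous.norm.add continuous_const)) hden⟩
  have hgg : g + g' = 1 := by
    ext r
    change ((‖q r‖ : ℝ) : ℂ) / ((‖q r‖ + m : ℝ) : ℂ) + (m : ℂ) / ((‖q r‖ + m : ℝ) : ℂ) = 1
    rw [← add_div, ← Complex.ofReal_add, div_self (hden r)]
  have hgn : ‖g * entryRatio S N o i‖ ≤ m⁻¹ := by
    refine (ContinuousMap.norm_le _ (by positivity)).2 fun r => ?_
    change ‖((‖q r‖ : ℝ) : ℂ) / ((‖q r‖ + m : ℝ) : ℂ) * entryRatio S N o i r‖ ≤ m⁻¹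
    rw [norm_mul, hqinv, norm_div, Complex.norm_of_nonneg (hq0 r).le,
      Complex.norm_of_nonneg (add_pos (hq0 r) hm0).le, div_mul_eq_mul_div,
      mul_inv_cancel₀ (hq0 r).ne', one_div]
    exact inv_anti₀ hm0 (le_add_of_nonneg_left (hq0 r).le)
  have hgn' : ‖g' * q‖ ≤ m := by
    refine (ContinuousMap.norm_le _ hm0.le).2 fun r => ?_
    change ‖(m : ℂ) / ((‖q r‖ + m : ℝ) : ℂ) * q r‖ ≤ m
    rw [norm_mul, norm_div, Complex.norm_of_nonneg hm0.le,
      Complex.norm_of_nonneg (add_pos (hq0 r) hm0).le, div_mul_eq_mul_div,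
      div_le_iff₀ (add_pos (hq0 r) hm0)]
    exact mul_le_mul_of_nonneg_left (le_add_of_nonneg_right hm0.le) hm0.le
  have hMM : (productMeasure S).real (cell N o k) = (productMeasure S).real (cell N o k') := by
    have h := cellCoeff_eq_cellCoeff p Φ N ho k k' 1
    rw [cellCoeff_one p Φ hS, cellCoeff_one p Φ hS] at h
    exact_mod_cast h
  set M := (productMeasure S).real (cell N o k) with hM
  have hM0 : 0 < M := ENNReal.toReal_pos (measure_cell_ne_zero S N o k) (measure_ne_top _ _)
  have b1 : ‖cellCoeff p Φ N o k g‖ ≤ Φ.bound * (m⁻¹ * ‖q k‖ * M) := by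
    refine (norm_cellCoeff_le p Φ hp hS N o i k g).trans
      (mul_le_mul_of_nonneg_left ?_ Φ.bound_nonneg)
    rw [hqinv, inv_inv]
    gcongr
  have b2 : ‖cellCoeff p Φ N o k g'‖ ≤ Φ.bound * (m * ‖q k'‖⁻¹ * M) := by
    rw [cellCoeff_eq_cellCoeff p Φ N ho k k' g']
    refine (norm_cellCoeff_le' p Φ hp hS N i o k' g').trans
      (mul_le_mul_of_nonneg_left ?_ Φ.bound_nonneg)
    rw [hMM]
    gcongr
  have hsum : M ≤ Φ.bound * (m⁻¹ * ‖q k‖ * M) + Φ.bound * (m * ‖q k'‖⁻¹ * M) := by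
    calc M = ‖cellCoeff p Φ N o k 1‖ := by
          rw [cellCoeff_one p Φ hS, Complex.norm_of_nonneg hM0.le]
      _ ≤ _ := by
          rw [← hgg, cellCoeff_add]
          exact (norm_add_le _ _).trans (add_le_add b1 b2)
  have hm2 : m ^ 2 = ‖q k‖ * ‖q k'‖ := Real.sq_sqrt (mul_pos (hq0 k) (hq0 k')).le
  -- Both terms of the bound are equal, since `m ^ 2 = ‖q k‖ * ‖q k'‖`.
  have hterm : m⁻¹ * ‖q k‖ = m * ‖q k'‖⁻¹ := by
    rw [← div_eq_mul_inv, eq_div_iff (hq0 k').ne', mul_assoc, ← hm2]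
    field_simp
  have h1 : 1 ≤ 2 * Φ.bound * (m * ‖q k'‖⁻¹) := by
    rw [hterm] at hsum
    refine le_of_mul_le_mul_right ?_ hM0
    linarith
  have h2 : ‖q k'‖ ≤ 2 * Φ.bound * m := by
    rw [← mul_assoc, ← div_eq_mul_inv, le_div_iff₀ (hq0 k'), one_mul] at h1
    exact h1
  have h3 : ‖q k'‖ ^ 2 ≤ 4 * Φ.bound ^ 2 * (‖q k‖ * ‖q k'‖) := by
    rw [← hm2]
    calc ‖q k'‖ ^ 2 ≤ (2 * Φ.bound * m) ^ 2 := by gcongr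
      _ = _ := by ring
  refine le_of_mul_le_mul_right ?_ (hq0 k')
  calc ‖q k'‖ * ‖q k'‖ = ‖q k'‖ ^ 2 := (sq _).symm
    _ ≤ _ := h3
    _ = _ := by ring

theorem prod_pBound_le (hp : p ≠ ∞) (hS : ∀ n, (S n).IsDiagonal) (N : ℕ) :
    ∏ n ∈ Finset.range N, (S n).pBound p ≤ ENNReal.ofReal (4 * Φ.bound ^ 2) := by
  choose o ho using fun n => (S n).one_mem_range
  have : ∀ n, Nonempty (I n) := fun n => ⟨o n⟩
  simp only [SimilaritySystem.pBound]
  refine prod_range_iSup_le _ N _ fun i => ?_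
  have : ∀ n, Nonempty (Fin (d n)) := fun n => ⟨⟨0, (S n).d_pos⟩⟩
  choose k' hk' using fun n => Finite.exists_max fun r => ‖(S n).s (i n) r r‖
  choose k hk using fun n => Finite.exists_min fun r => ‖(S n).s (i n) r r‖
  have hpos : ∀ n r, 0 < ‖(S n).s (i n) r r‖ := fun n r =>
    norm_pos_iff.2 ((hS n).apply_ne_zero _ _)
  have hfac : ∀ n, matrixLpNorm p ((S n).s (i n) : Matrix (Fin (d n)) (Fin (d n)) ℂ) *
      matrixLpNorm p (((S n).s (i n))⁻¹ : GL (Fin (d n)) ℂ).1 ≤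
      ENNReal.ofReal (‖(S n).s (i n) (k' n) (k' n)‖ * ‖(S n).s (i n) (k n) (k n)‖⁻¹) := by
    intro n
    rw [ENNReal.ofReal_mul (norm_nonneg _)]
    refine mul_le_mul' ?_ ?_
    · exact (congrArg (matrixLpNorm p) ((hS n).s_eq (i n))).trans_le
        (matrixLpNorm_diagonal_le p hp _ (hk' n) (norm_nonneg _))
    · rw [(hS n).s_inv_eq]
      refine matrixLpNorm_diagonal_le p hp _ (fun r => ?_) (inv_nonneg.2 (norm_nonneg _))
      rw [norm_inv]
      exact inv_anti₀ (hpos n _) (hk n r)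
  have hratio : ∀ r : ∀ n, Fin (d n),
      ‖entryRatio S N i o r‖ = ∏ n ∈ Finset.range N, ‖(S n).s (i n) (r n) (r n)‖ := by
    intro r
    rw [entryRatio_apply, norm_prod]
    exact Finset.prod_congr rfl fun n _ => by simp [ho n]
  refine (Finset.prod_le_prod' fun n _ => hfac n).trans ?_
  rw [← ENNReal.ofReal_prod_of_nonneg fun n _ => by positivity]
  refine ENNReal.ofReal_le_ofReal ?_
  rw [Finset.prod_mul_distrib, Finset.prod_inv_distrib, ← hratio, ← hratio, ← div_eq_mul_inv,
    div_le_iff₀ (norm_pos_iff.2 (entryRatio_ne_zero hS N i o k))]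
  exact norm_entryRatio_le p Φ hp hS N i ho k k'

end Bound

end

theorem mainTheorem5 (p : ℝ≥0∞) [Fact (1 ≤ p)] (hp : p ≠ ∞)
    (d : ℕ → ℕ) (hd : ∀ n, 2 ≤ d n)
    (I : ℕ → Type u) [∀ n, Countable (I n)]
    (S : ∀ n, SimilaritySystem (d n) (I n)) (hdiag : ∀ n, (S n).IsDiagonal)
    (hA : IsAmenable (uhfAlgebra p S)) :
    ∃ P : ℝ≥0, Tendsto (fun N : ℕ => ∏ n ∈ Finset.range N, (S n).pBound p) atTop
      (𝓝 (P : ℝ≥0∞)) := by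
  obtain ⟨Φ⟩ := hA.nonempty_averaging
  have hmono : Monotone fun N : ℕ => ∏ n ∈ Finset.range N, (S n).pBound p :=
    monotone_nat_of_le_succ fun N => by
      rw [Finset.prod_range_succ]
      exact le_mul_of_one_le_right' ((S N).one_le_pBound p)
  have hle : ⨆ N : ℕ, ∏ n ∈ Finset.range N, (S n).pBound p ≤ ENNReal.ofReal (4 * Φ.bound ^ 2) :=
    iSup_le fun N => prod_pBound_le p Φ hp hdiag N
  refine ⟨(⨆ N : ℕ, ∏ n ∈ Finset.range N, (S n).pBound p).toNNReal, ?_⟩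
  rw [ENNReal.coe_toNNReal (hle.trans_lt ENNReal.ofReal_lt_top).ne]
  exact tendsto_atTop_iSup hmono
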